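/- Let $p<q$ be odd primes with $\gcd(p-1,q-1)=4$. Let $g$ be an integer that is a primitive root modulo both $p$ and $q$, and let $h$ be an integer with $h\equiv g\pmod p$ and $h\equiv 1\pmod q$. Put $e=(p-1)(q-1)/4$ and, for $0\le i<4$, $$D_i=\{g^s h^i \bmod pq : s=0,1,\dots,e-1\}.$$ Put $P=\{p,2p,\dots,(q-1)p\}$, $Q=\{q,2q,\dots,(p-1)q\}$ and $R=\{0\}$. Let $e^\infty=(e_u)_{u\ge 0}$ be the $pq$-periodic sequence with values in $\mathbb Z_4=\{0,1,2,3\}$ given by $e_u=2$ if $u \bmod pq\in Q\cup R$, $e_u=0$ if $u\bmod pq\in P$, and $e_u=i$ if $u\bmod pq\in D_i$ $(i=0,1,2,3)$. Let $$\Phi_4(e^\infty)=\left\lceil \log_4\left(\frac{4^{pq}-1}{\gcd(E(4),\,4^{pq}-1)}\right)\right\rceil,\qquad E(X)=\sum_{u=0}^{pq-1}e_uX^u\in\mathbb Z[X],$$ be its 4-adic complexity. Then $$\Phi_4(e^\infty)>pq-\log_4(pq^2)-1.$$ Moreover, let $r_1=\gcd(p+3,4^q-1)$, and let $r_2=\gcd(q-1,4^p-1)$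 if $q\not\equiv 1\pmod 3$ and $r_2=\gcd(q-1,4^p-1)/3$ if $q\equiv 1\pmod 3$. Then $$\max(r_1,r_2)\le \frac{q-1}{4}\qquad\text{and}\qquad (6pq+1)\max(r_1,r_2)<\frac{3pq^2}{2}.$$ -/

import Mathlib

open Polynomial

noncomputable section

/-- The integer polynomial `S(X) = ∑_{i < T} s_i X^i` of an `m`-ary sequence with period `T`, where
each residue `s_i` is represented by the integer in `{0, 1, …, m - 1}`. -/
def generatingPoly (m T : ℕ) (s : ℕ → ZMod m) : ℤ[X] :=
  ∑ i ∈ Finset.range T, C ((s i).val : ℤ) * X ^ i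

/-- The `m`-adic complexity `⌈log_m ((m^T - 1) / gcd(S(m), m^T - 1))⌉` of a `T`-periodic `m`-ary
sequence (meaningful for `m ≥ 2` and `T ≥ 1`). -/
def adicComplexity (m T : ℕ) (s : ℕ → ZMod m) : ℤ :=
  ⌈Real.logb (m : ℝ)
    (((m : ℝ) ^ T - 1) /
      (Int.gcd ((generatingPoly m T s).eval (m : ℤ)) ((m : ℤ) ^ T - 1) : ℝ))⌉

/-- `g` is a primitive root modulo `n` for a prime `n`. -/
def IsPrimitiveRootModPrime (g : ℤ) (n : ℕ) : Prop :=
  orderOf (g : ZMod n) = n - 1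

/-- The generalized cyclotomic class of order four
`D_i = {g^s h^i mod pq : s = 0, 1, …, e - 1}` with `e = (p - 1)(q - 1) / 4`. -/
def cyclotomicClass (p q : ℕ) (g h : ℤ) (i : ℕ) : Set (ZMod (p * q)) :=
  {x | ∃ s : ℕ, s < (p - 1) * (q - 1) / 4 ∧ x = (g : ZMod (p * q)) ^ s * (h : ZMod (p * q)) ^ i}

/-- The residues `{p, 2p, …, (q - 1)p}` modulo `pq`. -/
def multiplesP (p q : ℕ) : Set (ZMod (p * q)) :=
  {x | ∃ k : ℕ, 1 ≤ k ∧ k ≤ q - 1 ∧ x = ((k * p : ℕ) : ZMod (p * q))}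

/-- The residues `{q, 2q, …, (p - 1)q}` modulo `pq`. -/
def multiplesQ (p q : ℕ) : Set (ZMod (p * q)) :=
  {x | ∃ k : ℕ, 1 ≤ k ∧ k ≤ p - 1 ∧ x = ((k * q : ℕ) : ZMod (p * q))}

open Classical in
/-- The two-prime quaternary sequence of period `pq`. For the `p, q, g, h` considered, the sets in
the successive cases are disjoint and cover all residues, so the last value is never taken. -/
def twoPrimeQuaternary (p q : ℕ) (g h : ℤ) (u : ℕ) : ZMod 4 :=
  let x : ZMod (p * q) := (u : ZMod (p * q))
  if x ∈ multiplesQ p q ∪ {0} then 2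
  else if x ∈ multiplesP p q then 0
  else if x ∈ cyclotomicClass p q g h 0 then 0
  else if x ∈ cyclotomicClass p q g h 1 then 1
  else if x ∈ cyclotomicClass p q g h 2 then 2
  else if x ∈ cyclotomicClass p q g h 3 then 3
  else 0

/-- `r₁ = gcd(p + 3, 4^q - 1)`. -/
def rOne (p q : ℕ) : ℕ := Nat.gcd (p + 3) (4 ^ q - 1)

/-- `r₂ = gcd(q - 1, 4^p - 1)`, divided by `3` when `q ≡ 1 (mod 3)`; that division is exact. -/
def rTwo (p q : ℕ) : ℕ :=
  if q % 3 = 1 then Nat.gcd (q - 1) (4 ^ p - 1) / 3 else Nat.gcd (q - 1) (4 ^ p - 1)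

end

/-! Write `N = pq` and `S = E(4)`. The complexity bound amounts to `gcd(S, 4^N - 1) < 4pq²`, since
`log_4 (4pq²) = log_4 (pq²) + 1`.

Take quartic characters `χ` mod `p` and `φ` mod `q` with `χ(g) = i`, `φ(g) = -i`. Then `χφ` is `i^k`
on `D_k`, so `2e_u` is a combination of `χφ`, its inverse, its square and indicator functions.
Orthogonality gives `2S` modulo `4^p - 1` and `4^q - 1` (`two_mul_eval_modEq_left`,
`two_mul_eval_modEq_right`). Consequently `S` is coprime to `4^q - 1`, and `d = gcd(S, 4^p - 1)` is
odd and divides `q - 1`, so `4d ≤ q - 1`.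

What remains is `n = gcd(S, Φ_N(4))`. Modulo each prime factor of `n` the order of 4 is exactly `N`,
whence `n = 1 + 2Nt`. At a primitive `N`-th root of unity, `2E` is expressed by Gauss sums. The
square of its quartic part is `4βΓ + 4εN`, where `Γ` is the quadratic Gauss sum product, `Γ² = N`,
and `β` is an integer with `β² ≤ N` obtained from Jacobi sums (`quartic_gaussSum_product_relation`).
These relations have integer coefficients, so they specialise to 4 modulo `Φ_N(4)`. Setting `S ≡ 0`
and eliminating `Γ` gives `n ∣ N(4β+6)² - (9+(1-4ε)N)²`, a number of order `N²` and congruent to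
`-81` mod `N`. Together with `n ≡ 1` mod `N` this makes `t` small enough that `dn < 4Nq`.

The bounds on `r₁`, `r₂` are independent of this: both are odd, while `p + 3` and `q - 1` are
multiples of 4. -/

/-! ### Characters with a prescribed value at a primitive root. -/

theorem ZMod.exists_eq_pow_of_orderOf_eq {p : ℕ} [Fact p.Prime] {γ : ZMod p}
    (hγ : orderOf γ = p - 1) {a : ZMod p} (ha : a ≠ 0) : ∃ m : ℕ, a = γ ^ m := by
  have hp := (Fact.out : p.Prime).two_le
  have hγ0 : γ ≠ 0 := by
    rintro rfl
    have : orderOf (0 : ZMod p) = 0 := orderOf_eq_zero_iff'.2 fun n hn => by simp [hn.ne']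
    omega
  have hcard : orderOf (Units.mk0 γ hγ0) = Nat.card (ZMod p)ˣ := by
    rw [Nat.card_eq_fintype_card, ZMod.card_units, ← hγ, ← orderOf_units, Units.val_mk0]
  have hz : Units.mk0 a ha ∈ Subgroup.zpowers (Units.mk0 γ hγ0) := by
    rw [Subgroup.eq_top_of_card_eq (Subgroup.zpowers (Units.mk0 γ hγ0))
      (by rw [Nat.card_zpowers, hcard])]
    trivial
  obtain ⟨m, hm⟩ := (mem_powers_iff_mem_zpowers).2 hz
  exact ⟨m, by simpa using (congrArg Units.val hm).symm⟩

theorem ZMod.exists_mulChar_apply_eq {p : ℕ} [Fact p.Prime] {γ : ZMod p}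
    (hγ : orderOf γ = p - 1) {n : ℕ} (hn : n ∣ p - 1) {ω : ℂ} (hω : ω ^ n = 1) (hn0 : n ≠ 0) :
    ∃ χ : MulChar (ZMod p) ℂ, χ γ = ω := by
  have hp := (Fact.out : p.Prime).two_le
  have hγ0 : γ ≠ 0 := by
    rintro rfl
    have : orderOf (0 : ZMod p) = 0 := orderOf_eq_zero_iff'.2 fun n hn => by simp [hn.ne']
    omega
  have hg : ∀ x, x ∈ Subgroup.zpowers (Units.mk0 γ hγ0) := fun x => by
    obtain ⟨m, hm⟩ := ZMod.exists_eq_pow_of_orderOf_eq hγ x.ne_zero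
    exact ⟨m, Units.ext (by simpa using hm.symm)⟩
  have hω0 : ω ≠ 0 := by rintro rfl; simp [hn0] at hω
  have hmem : Units.mk0 ω hω0 ∈ rootsOfUnity (Fintype.card (ZMod p)ˣ) ℂ := by
    rw [mem_rootsOfUnity, ZMod.card_units]
    obtain ⟨k, hk⟩ := hn
    ext
    simp [hk, pow_mul, hω]
  exact ⟨MulChar.ofRootOfUnity hmem hg, by simpa using MulChar.ofRootOfUnity_spec hmem hg⟩

theorem Complex.mem_range_toComplex_of_pow_four {z : ℂ} (hz : z ^ 4 = 1) :
    z ∈ GaussianInt.toComplex.range := by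
  have h : (z - 1) * (z + 1) * (z - Complex.I) * (z + Complex.I) = 0 := by
    linear_combination hz - (z ^ 2 - 1) * Complex.I_sq
  have hI : Complex.I ∈ GaussianInt.toComplex.range := ⟨⟨0, 1⟩, by simp [GaussianInt.toComplex_def]⟩
  rcases mul_eq_zero.1 h with h | h
  · rcases mul_eq_zero.1 h with h | h
    · rcases mul_eq_zero.1 h with h | h
      · rw [sub_eq_zero.1 h]; exact one_mem _
      · rw [eq_neg_of_add_eq_zero_left h]; exact neg_mem (one_mem _)
    · rw [sub_eq_zero.1 h]; exact hI
  · rw [eq_neg_of_add_eq_zero_left h]; exact neg_mem hI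

theorem inv_mul_inv_eq_of_pow_four {G : Type*} [CommGroup G] {χ : G} (h4 : χ ^ 4 = 1) : χ⁻¹ * χ⁻¹ = χ ^ 2 := by
  rw [← mul_inv, inv_eq_iff_mul_eq_one, ← sq, ← pow_add, h4]

/-! ### Gauss and Jacobi sums of quartic characters. -/

section QuarticChar

variable {p : ℕ} [Fact p.Prime] {χ : MulChar (ZMod p) ℂ}

theorem MulChar.apply_pow_four (h4 : χ ^ 4 = 1) {a : ZMod p} (ha : a ≠ 0) : χ a ^ 4 = 1 := by
  rw [← MulChar.pow_apply' χ (by norm_num), h4, MulChar.one_apply ha.isUnit]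

theorem MulChar.mem_range_toComplex (h4 : χ ^ 4 = 1) (a : ZMod p) :
    χ a ∈ GaussianInt.toComplex.range := by
  rcases eq_or_ne a 0 with rfl | ha
  · rw [MulChar.map_zero]; exact zero_mem _
  · exact Complex.mem_range_toComplex_of_pow_four (MulChar.apply_pow_four h4 ha)

/-- The values of `χ` are Gaussian integers, and inverting `χ` conjugates them. -/
theorem exists_jacobiSum_quartic (h4 : χ ^ 4 = 1) :
    ∃ a b : ℤ, jacobiSum χ χ = a + b * Complex.I ∧ jacobiSum χ⁻¹ χ⁻¹ = a - b * Complex.I := by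
  have hmem : jacobiSum χ χ ∈ GaussianInt.toComplex.range :=
    sum_mem fun x _ => mul_mem (MulChar.mem_range_toComplex h4 _) (MulChar.mem_range_toComplex h4 _)
  obtain ⟨z, hz⟩ := hmem
  have hz' : jacobiSum χ χ = z.re + z.im * Complex.I := by rw [← hz, GaussianInt.toComplex_def]
  refine ⟨z.re, z.im, hz', ?_⟩
  have : jacobiSum χ⁻¹ χ⁻¹ = star (jacobiSum χ χ) := by
    simp [jacobiSum, ← MulChar.star_apply']
  rw [this, hz']
  simp [sub_eq_add_neg]

variable {ψ : AddChar (ZMod p) ℂ}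

/-- `χ ^ 2` is its own inverse, and it is even because it sends `-1` to `χ ((-1) ^ 2) = 1`; hence no
sign appears. -/
theorem gaussSum_quartic_sq_sq (h4 : χ ^ 4 = 1) (h2 : χ ^ 2 ≠ 1) (hψ : ψ.IsPrimitive) :
    gaussSum (χ ^ 2) ψ ^ 2 = p := by
  have hq : (χ ^ 2)⁻¹ = χ ^ 2 := by rw [inv_eq_iff_mul_eq_one, ← pow_add, h4]
  have h := gaussSum_mul_gaussSum_eq_card h2 hψ
  have h' := mul_gaussSum_inv_eq_gaussSum (χ ^ 2) ψ
  rw [hq, ZMod.card] at h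
  have h1 : (χ ^ 2) (-1) = 1 := by
    rw [MulChar.pow_apply' χ (by norm_num), ← map_pow]; simp
  rw [h1, one_mul] at h'
  rw [h', ← sq] at h
  exact h

theorem gaussSum_quartic_mul_inv (h2 : χ ^ 2 ≠ 1) (hψ : ψ.IsPrimitive) :
    gaussSum χ ψ * gaussSum χ⁻¹ ψ = χ (-1) * p := by
  have h1 : χ ≠ 1 := by rintro rfl; simp at h2
  have h := gaussSum_mul_gaussSum_eq_card h1 hψ
  have h' := mul_gaussSum_inv_eq_gaussSum χ⁻¹ ψ
  rw [ZMod.card] at h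
  have hi : χ⁻¹ (-1) = χ (-1) := by rw [MulChar.inv_apply']; norm_num
  rw [← h', ← h, hi]; ring

theorem gaussSum_quartic_sq (h2 : χ ^ 2 ≠ 1) (ψ : AddChar (ZMod p) ℂ) :
    gaussSum χ ψ ^ 2 = gaussSum (χ ^ 2) ψ * jacobiSum χ χ := by
  rw [sq χ, jacobiSum_mul_nontrivial (by rwa [← sq]), sq]

theorem gaussSum_quartic_inv_sq (h4 : χ ^ 4 = 1) (h2 : χ ^ 2 ≠ 1) (ψ : AddChar (ZMod p) ℂ) :
    gaussSum χ⁻¹ ψ ^ 2 = gaussSum (χ ^ 2) ψ * jacobiSum χ⁻¹ χ⁻¹ := by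
  have h := inv_mul_inv_eq_of_pow_four h4
  rw [← h, jacobiSum_mul_nontrivial (by rwa [h]), sq]

theorem jacobiSum_quartic_mul_inv (h4 : χ ^ 4 = 1) (h2 : χ ^ 2 ≠ 1) :
    jacobiSum χ χ * jacobiSum χ⁻¹ χ⁻¹ = p := by
  have h1 : χ ≠ 1 := by rintro rfl; simp at h2
  have hp := (Fact.out : p.Prime).ne_zero
  rw [jacobiSum_mul_jacobiSum_inv _ h1 h1 (by rwa [← sq]), ZMod.card]
  rw [ZMod.ringChar_zmod_n, ringChar.eq_zero]; exact hp.symm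

/-- Integrality lets the quadratic Gauss sum be written as an integer polynomial in a root of unity,
which can later be evaluated at 4. -/
theorem exists_int_quartic_sq (h4 : χ ^ 4 = 1) (a : ZMod p) : ∃ c : ℤ, (c : ℂ) = (χ ^ 2) a := by
  rcases eq_or_ne a 0 with rfl | ha
  · exact ⟨0, by rw [MulChar.map_zero, Int.cast_zero]⟩
  · have h := MulChar.apply_pow_four h4 ha
    rw [MulChar.pow_apply' χ (by norm_num)]
    have : (χ a ^ 2 - 1) * (χ a ^ 2 + 1) = 0 := by linear_combination h
    rcases mul_eq_zero.1 this with h | h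
    · exact ⟨1, by simp [sub_eq_zero.1 h]⟩
    · exact ⟨-1, by simp [eq_neg_of_add_eq_zero_left h]⟩

end QuarticChar

/-- The relation between the combination `(-1 + i) G(χ) + (-1 - i) G(χ⁻¹)` of quartic Gauss sums
modulo `pq` and the quadratic Gauss sum. -/
theorem quartic_gaussSum_product_relation {p q : ℕ} [Fact p.Prime] [Fact q.Prime]
    {χ : MulChar (ZMod p) ℂ} {φ : MulChar (ZMod q) ℂ} {ψ : AddChar (ZMod p) ℂ}
    {θ : AddChar (ZMod q) ℂ} (h4 : χ ^ 4 = 1) (h2 : χ ^ 2 ≠ 1) (h4' : φ ^ 4 = 1) (h2' : φ ^ 2 ≠ 1)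
    (hψ : ψ.IsPrimitive) (hθ : θ.IsPrimitive) {ε : ℤ} (hε : χ (-1) * φ (-1) = ε) :
    ∃ β : ℤ, β ^ 2 ≤ p * q ∧
      ((-1 + Complex.I) * (gaussSum χ ψ * gaussSum φ θ) +
        (-1 - Complex.I) * (gaussSum χ⁻¹ ψ * gaussSum φ⁻¹ θ)) ^ 2 =
      4 * β * (gaussSum (χ ^ 2) ψ * gaussSum (φ ^ 2) θ) + 4 * ε * (p * q) := by
  obtain ⟨a, b, hJ, hJ'⟩ := exists_jacobiSum_quartic h4
  obtain ⟨c, d, hK, hK'⟩ := exists_jacobiSum_quartic h4'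
  have hab : a ^ 2 + b ^ 2 = (p : ℤ) := by
    have h := jacobiSum_quartic_mul_inv h4 h2
    rw [hJ, hJ'] at h
    have : ((a ^ 2 + b ^ 2 : ℤ) : ℂ) = ((p : ℤ) : ℂ) := by
      push_cast; linear_combination h + b ^ 2 * Complex.I_sq
    exact_mod_cast this
  have hcd : c ^ 2 + d ^ 2 = (q : ℤ) := by
    have h := jacobiSum_quartic_mul_inv h4' h2'
    rw [hK, hK'] at h
    have : ((c ^ 2 + d ^ 2 : ℤ) : ℂ) = ((q : ℤ) : ℂ) := by
      push_cast; linear_combination h + d ^ 2 * Complex.I_sq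
    exact_mod_cast this
  -- `β` is the imaginary part of the product of the two Jacobi sums; its bound is the two-squares
  -- identity `(ad+bc)² + (ac-bd)² = (a²+b²)(c²+d²)`.
  refine ⟨a * d + b * c, ?_, ?_⟩
  · rw [← hab, ← hcd]; nlinarith [sq_nonneg (a * c - b * d)]
  · have e1 := gaussSum_quartic_sq h2 ψ
    have e2 := gaussSum_quartic_sq h2' θ
    have e3 := gaussSum_quartic_inv_sq h4 h2 ψ
    have e4 := gaussSum_quartic_inv_sq h4' h2' θ
    have e5 := gaussSum_quartic_mul_inv h2 hψ
    have e6 := gaussSum_quartic_mul_inv h2' hθ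
    rw [hJ] at e1
    rw [hK] at e2
    rw [hJ'] at e3
    rw [hK'] at e4
    generalize gaussSum χ ψ = G at *
    generalize gaussSum φ θ = H at *
    generalize gaussSum χ⁻¹ ψ = G' at *
    generalize gaussSum φ⁻¹ θ = H' at *
    generalize gaussSum (χ ^ 2) ψ = K at *
    generalize gaussSum (φ ^ 2) θ = K' at *
    have f1 : (G * H) ^ 2 = K * K' * ((a + b * Complex.I) * (c + d * Complex.I)) := by
      rw [mul_pow, e1, e2]; ring
    have f2 : (G' * H') ^ 2 = K * K' * ((a - b * Complex.I) * (c - d * Complex.I)) := by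
      rw [mul_pow, e3, e4]; ring
    have f3 : (G * H) * (G' * H') = ε * (p * q) := by
      rw [← hε]; linear_combination H * H' * e5 + χ (-1) * p * e6
    have hI := Complex.I_sq
    generalize Complex.I = i at *
    push_cast
    -- The coefficients satisfy `(-1±i)² = ∓2i` and `(-1+i)(-1-i) = 2`, so only the imaginary part
    -- of the Jacobi product survives.
    have f0 : ((-1 + i) * (G * H) + (-1 - i) * (G' * H')) ^ 2 =
        -2 * i * (G * H) ^ 2 + 2 * i * (G' * H') ^ 2 + 4 * ((G * H) * (G' * H')) := by
      linear_combination ((G * H) ^ 2 + (G' * H') ^ 2 - 2 * (G * H) * (G' * H')) * hI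
    rw [f0, f1, f2, f3]
    linear_combination (-4 * K * K' * (a * d + b * c)) * hI

/-! ### Cyclotomic classes and the character expansion of the sequence. -/

theorem ZMod.natCast_eq_intCast_mul_iff {p q : ℕ} (hpq : p.Coprime q) (u : ℕ) (z : ℤ) :
    (u : ZMod (p * q)) = (z : ZMod (p * q)) ↔ (u : ZMod p) = z ∧ (u : ZMod q) = z := by
  have h (n : ℕ) : (u : ZMod n) = (z : ZMod n) ↔ (u : ℤ) ≡ z [ZMOD n] := by
    rw [← ZMod.intCast_eq_intCast_iff]; simp
  rw [h, h, h, Int.modEq_and_modEq_iff_modEq_mul (by simpa using hpq)]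
  push_cast; rfl

theorem mem_multiplesQ_union_zero_iff {p q : ℕ} (hp : 0 < p) (hpq : p.Coprime q)
    (u : ℕ) :
    (u : ZMod (p * q)) ∈ multiplesQ p q ∪ {0} ↔ (u : ZMod q) = 0 := by
  constructor
  · rintro (⟨k, -, -, hk⟩ | hk)
    · have := (ZMod.natCast_eq_intCast_mul_iff hpq u ((k * q : ℕ) : ℤ)).1 (by rw [hk]; push_cast; rfl)
      rw [this.2]; simp
    · have := (ZMod.natCast_eq_intCast_mul_iff hpq u 0).1 (by simpa using hk)
      simpa using this.2
  · intro hu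
    obtain ⟨k, rfl⟩ := (ZMod.natCast_eq_zero_iff u q).1 hu
    have hmod : ((q * k : ℕ) : ZMod (p * q)) = ((k % p * q : ℕ) : ZMod (p * q)) := by
      rw [ZMod.natCast_eq_natCast_iff, mul_comm q k]
      exact (Nat.ModEq.mul_right' q (Nat.mod_modEq k p)).symm
    rcases Nat.eq_zero_or_pos (k % p) with h0 | h0
    · right; rw [hmod, h0]; simp
    · left
      have := Nat.mod_lt k hp
      exact ⟨k % p, h0, by omega, hmod⟩

theorem mem_multiplesP_iff {p q : ℕ} (hq : 0 < q) (hpq : p.Coprime q) (u : ℕ)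
    (hu : (u : ZMod q) ≠ 0) :
    (u : ZMod (p * q)) ∈ multiplesP p q ↔ (u : ZMod p) = 0 := by
  constructor
  · rintro ⟨k, -, -, hk⟩
    have := (ZMod.natCast_eq_intCast_mul_iff hpq u ((k * p : ℕ) : ℤ)).1 (by rw [hk]; push_cast; rfl)
    rw [this.1]; simp
  · intro hu'
    obtain ⟨k, rfl⟩ := (ZMod.natCast_eq_zero_iff u p).1 hu'
    have hmod : ((p * k : ℕ) : ZMod (p * q)) = ((k % q * p : ℕ) : ZMod (p * q)) := by
      rw [ZMod.natCast_eq_natCast_iff, mul_comm p k, mul_comm p q]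
      exact (Nat.ModEq.mul_right' p (Nat.mod_modEq k q)).symm
    have h0 : k % q ≠ 0 := fun h0 => hu <| by
      rw [ZMod.natCast_eq_zero_iff]
      exact (Nat.dvd_of_mod_eq_zero h0).mul_left p
    have := Nat.mod_lt k hq
    exact ⟨k % q, by omega, by omega, hmod⟩

section Classes

variable {p q : ℕ} [Fact p.Prime] [Fact q.Prime] {g h : ℤ}
  {χ : MulChar (ZMod p) ℂ} {φ : MulChar (ZMod q) ℂ}

/-- At `g` the product character is `i · (-i) = 1`, while at `h`, which is `g` mod `p` and 1 mod
`q`, it is `i`. -/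
theorem mulChar_mul_of_mem_cyclotomicClass (hpq : p.Coprime q)
    (hhp : (h : ZMod p) = g) (hhq : (h : ZMod q) = 1)
    (hχ : χ (g : ZMod p) = Complex.I) (hφ : φ (g : ZMod q) = -Complex.I) {u i : ℕ}
    (hu : (u : ZMod (p * q)) ∈ cyclotomicClass p q g h i) :
    χ (u : ZMod p) * φ (u : ZMod q) = Complex.I ^ i := by
  obtain ⟨s, -, hs⟩ := hu
  obtain ⟨h1, h2⟩ := (ZMod.natCast_eq_intCast_mul_iff hpq u (g ^ s * h ^ i)).1
    (by rw [hs]; push_cast; rfl)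
  rw [h1, h2]
  push_cast
  rw [hhp, hhq, one_pow, mul_one, map_mul, map_pow, map_pow, map_pow, hχ, hφ]
  have : Complex.I * -Complex.I = 1 := by simp
  calc Complex.I ^ s * Complex.I ^ i * (-Complex.I) ^ s
      = (Complex.I * -Complex.I) ^ s * Complex.I ^ i := by rw [mul_pow]; ring
    _ = Complex.I ^ i := by rw [this, one_pow, one_mul]

/-- For `u` equal to `g^a` mod `p` and `g^b` mod `q`, one needs `s + i ≡ a` mod `p - 1` and `s ≡ b`
mod `q - 1`. These are compatible exactly when `i ≡ a - b` mod 4, and `s` matters only modulo the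
lcm, which is `e`. -/
theorem exists_mem_cyclotomicClass (hpq : p.Coprime q) (hgcd : Nat.gcd (p - 1) (q - 1) = 4)
    (hgp : IsPrimitiveRootModPrime g p) (hgq : IsPrimitiveRootModPrime g q)
    (hhp : (h : ZMod p) = g) (hhq : (h : ZMod q) = 1) {u : ℕ}
    (hu : (u : ZMod p) ≠ 0) (hu' : (u : ZMod q) ≠ 0) :
    ∃ i < 4, (u : ZMod (p * q)) ∈ cyclotomicClass p q g h i := by
  obtain ⟨a, ha⟩ := ZMod.exists_eq_pow_of_orderOf_eq hgp hu
  obtain ⟨b, hb⟩ := ZMod.exists_eq_pow_of_orderOf_eq hgq hu'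
  have hp2 := (Fact.out : p.Prime).two_le
  have hq2 := (Fact.out : q.Prime).two_le
  have hdp : 4 ∣ p - 1 := hgcd ▸ Nat.gcd_dvd_left _ _
  have hlcm : (p - 1) * (q - 1) / 4 = Nat.lcm (p - 1) (q - 1) := by rw [Nat.lcm, hgcd]
  -- Adding `p - 1` leaves the exponent class unchanged and prevents truncation in the natural
  -- subtraction; `a + 3b` represents `a - b` mod 4.
  obtain ⟨i, hi, hiab⟩ : ∃ i < 4, (a + (p - 1) - i) % 4 = b % 4 :=
    ⟨(a + 3 * b) % 4, by omega, by omega⟩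
  obtain ⟨s, hs1, hs2⟩ := Nat.chineseRemainder' (n := p - 1) (m := q - 1)
    (a := a + (p - 1) - i) (b := b) (by rw [hgcd]; exact hiab)
  have hpos : 0 < Nat.lcm (p - 1) (q - 1) := Nat.lcm_pos (by omega) (by omega)
  have hr1 : s % Nat.lcm (p - 1) (q - 1) ≡ s [MOD p - 1] :=
    (Nat.mod_modEq _ _).of_dvd (Nat.dvd_lcm_left _ _)
  have hr2 : s % Nat.lcm (p - 1) (q - 1) ≡ s [MOD q - 1] :=
    (Nat.mod_modEq _ _).of_dvd (Nat.dvd_lcm_right _ _)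
  refine ⟨i, hi, s % Nat.lcm (p - 1) (q - 1), by rw [hlcm]; exact Nat.mod_lt _ hpos, ?_⟩
  generalize s % Nat.lcm (p - 1) (q - 1) = r at *
  have := (ZMod.natCast_eq_intCast_mul_iff hpq u (g ^ r * h ^ i)).2 ?_
  · rw [this]; push_cast; rfl
  · push_cast
    rw [hhp, hhq, one_pow, mul_one, ← pow_add, ha, hb]
    constructor
    · refine pow_eq_pow_of_modEq ?_ (pow_orderOf_eq_one _)
      rw [hgp]
      have h1 : r + i ≡ a + (p - 1) - i + i [MOD p - 1] := (hr1.trans hs1).add_right i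
      rw [Nat.sub_add_cancel (by omega)] at h1
      exact (h1.trans (by simp [Nat.ModEq])).symm
    · refine pow_eq_pow_of_modEq ?_ (pow_orderOf_eq_one _)
      rw [hgq]
      exact (hr2.trans hs2).symm

/-- The quartic character expansion of the two-prime quaternary sequence. -/
theorem two_mul_twoPrimeQuaternary_val (hpq : p.Coprime q)
    (hgcd : Nat.gcd (p - 1) (q - 1) = 4)
    (hgp : IsPrimitiveRootModPrime g p) (hgq : IsPrimitiveRootModPrime g q)
    (hhp : (h : ZMod p) = g) (hhq : (h : ZMod q) = 1)
    (hχ : χ (g : ZMod p) = Complex.I) (hφ : φ (g : ZMod q) = -Complex.I) (u : ℕ) :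
    2 * ((twoPrimeQuaternary p q g h u).val : ℂ) =
      3 * ((1 : MulChar (ZMod p) ℂ) u * (1 : MulChar (ZMod q) ℂ) u)
      + (if (u : ZMod q) = 0 then 4 else 0) - (χ ^ 2) u * (φ ^ 2) u
      + (-1 + Complex.I) * (χ u * φ u) + (-1 - Complex.I) * (χ⁻¹ u * φ⁻¹ u) := by
  have hp0 := (Fact.out : p.Prime).pos
  have hq0 := (Fact.out : q.Prime).pos
  have hQ := mem_multiplesQ_union_zero_iff hp0 hpq u
  have h2v : (2 : ZMod 4).val = 2 := rfl
  have h3v : (3 : ZMod 4).val = 3 := rfl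
  have h1v : (1 : ZMod 4).val = 1 := rfl
  by_cases hu' : (u : ZMod q) = 0
  · simp only [twoPrimeQuaternary]
    rw [if_pos (hQ.2 hu'), if_pos hu', hu']
    simp only [MulChar.map_zero, h2v]
    norm_num
  have hP := mem_multiplesP_iff hq0 hpq u hu'
  by_cases hu : (u : ZMod p) = 0
  · simp only [twoPrimeQuaternary]
    rw [if_neg (hQ.not.2 hu'), if_pos (hP.2 hu), if_neg hu', hu]
    simp only [MulChar.map_zero, ZMod.val_zero]
    norm_num
  have hD : ∀ {i : ℕ}, (u : ZMod (p * q)) ∈ cyclotomicClass p q g h i →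
      χ (u : ZMod p) * φ (u : ZMod q) = Complex.I ^ i :=
    fun hi => mulChar_mul_of_mem_cyclotomicClass hpq hhp hhq hχ hφ hi
  obtain ⟨i, hi, hmem⟩ := exists_mem_cyclotomicClass hpq hgcd hgp hgq hhp hhq hu hu'
  have hval : (twoPrimeQuaternary p q g h u).val = i := by
    have hne : ∀ j < 4, (u : ZMod (p * q)) ∈ cyclotomicClass p q g h j → j = i := by
      intro j hj hmj
      have hI : Complex.I ^ j = Complex.I ^ i := (hD hmj).symm.trans (hD hmem)
      have hI2 := Complex.I_sq
      have hI3 : Complex.I ^ 3 = -Complex.I := by rw [pow_succ, hI2]; ring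
      interval_cases j <;> interval_cases i <;>
        simp [hI3, Complex.ext_iff] at hI ⊢ <;> norm_num at hI
    simp only [twoPrimeQuaternary]
    rw [if_neg (hQ.not.2 hu'), if_neg (hP.not.2 hu)]
    have hiff : ∀ j < 4, (u : ZMod (p * q)) ∈ cyclotomicClass p q g h j ↔ i = j := fun j hj =>
      ⟨fun hm => (hne j hj hm).symm, fun hm => hm ▸ hmem⟩
    simp only [hiff 0 (by norm_num), hiff 1 (by norm_num), hiff 2 (by norm_num),
      hiff 3 (by norm_num)]
    interval_cases i <;> simp [h1v, h2v, h3v]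
  have hX := hD hmem
  have hXinv : χ⁻¹ (u : ZMod p) * φ⁻¹ (u : ZMod q) = (Complex.I ^ i)⁻¹ := by
    rw [MulChar.inv_apply_eq_inv', MulChar.inv_apply_eq_inv', ← hX, mul_inv]
  have hXsq : (χ ^ 2) (u : ZMod p) * (φ ^ 2) (u : ZMod q) = (Complex.I ^ i) ^ 2 := by
    rw [MulChar.pow_apply' _ (by norm_num), MulChar.pow_apply' _ (by norm_num), ← hX, mul_pow]
  rw [hval, hX, hXinv, hXsq, if_neg hu', MulChar.one_apply (Ne.isUnit hu),
    MulChar.one_apply (Ne.isUnit hu')]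
  have hI2 := Complex.I_sq
  have hI3 : Complex.I ^ 3 = -Complex.I := by rw [pow_succ, hI2]; ring
  interval_cases i
  · norm_num; ring
  · rw [pow_one, Complex.inv_I]; linear_combination (-2 : ℂ) * hI2 + hI2
  · rw [hI2]; norm_num; ring
  · rw [hI3, inv_neg, Complex.inv_I]; linear_combination (2 : ℂ) * hI2 + hI2

end Classes

/-! ### The generating polynomial modulo `4^p - 1`, `4^q - 1` and `Φ_pq(4)`. -/

theorem ZMod.sum_range_natCast {R : Type*} [AddCommMonoid R] (n : ℕ) [NeZero n] (F : ZMod n → R) :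
    ∑ u ∈ Finset.range n, F (u : ZMod n) = ∑ x : ZMod n, F x := by
  refine Finset.sum_bij' (fun u _ => (u : ZMod n)) (fun x _ => x.val) (by simp)
    (fun x _ => by simpa using ZMod.val_lt x) (fun u hu => ?_) (by simp) (by simp)
  exact ZMod.val_cast_of_lt (by simpa using hu)

theorem ZMod.sum_range_mul_natCast {R : Type*} [AddCommMonoid R] {p q : ℕ} [NeZero p] [NeZero q]
    (hpq : p.Coprime q) (F : ZMod p → ZMod q → R) :
    ∑ u ∈ Finset.range (p * q), F u u = ∑ a, ∑ b, F a b := by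
  rw [← Fintype.sum_prod_type' F, ← Equiv.sum_comp (ZMod.chineseRemainder hpq).toEquiv,
    ← ZMod.sum_range_natCast]
  refine Finset.sum_congr rfl fun u _ => ?_
  simp

section

variable {p q : ℕ} [Fact p.Prime] [Fact q.Prime] {g h : ℤ}
  {χ : MulChar (ZMod p) ℂ} {φ : MulChar (ZMod q) ℂ}

/-- The values of the two-prime quaternary sequence as a function of the two residues. -/
noncomputable def twoPrimeValue (hpq : p.Coprime q) (g h : ℤ) (a : ZMod p) (b : ZMod q) : ℤ :=
  (twoPrimeQuaternary p q g h ((ZMod.chineseRemainder hpq).symm (a, b)).val).val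

theorem twoPrimeValue_natCast (hpq : p.Coprime q) (g h : ℤ) (u : ℕ) :
    twoPrimeValue hpq g h u u = (twoPrimeQuaternary p q g h u).val := by
  have key : (((ZMod.chineseRemainder hpq).symm ((u : ZMod p), (u : ZMod q))).val : ZMod (p * q)) =
      (u : ZMod (p * q)) := by
    rw [ZMod.natCast_zmod_val, RingEquiv.symm_apply_eq, map_natCast]
    rfl
  unfold twoPrimeValue twoPrimeQuaternary
  rw [key]

theorem exists_natCast_eq_and (hpq : p.Coprime q) (a : ZMod p) (b : ZMod q) :
    ∃ u : ℕ, (u : ZMod p) = a ∧ (u : ZMod q) = b := by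
  obtain ⟨u, h1, h2⟩ := Nat.chineseRemainder hpq a.val b.val
  rw [← ZMod.natCast_eq_natCast_iff] at h1 h2
  exact ⟨u, by simpa using h1, by simpa using h2⟩

theorem two_mul_twoPrimeValue (hpq : p.Coprime q)
    (hgcd : Nat.gcd (p - 1) (q - 1) = 4)
    (hgp : IsPrimitiveRootModPrime g p) (hgq : IsPrimitiveRootModPrime g q)
    (hhp : (h : ZMod p) = g) (hhq : (h : ZMod q) = 1)
    (hχ : χ (g : ZMod p) = Complex.I) (hφ : φ (g : ZMod q) = -Complex.I)
    (a : ZMod p) (b : ZMod q) :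
    2 * (twoPrimeValue hpq g h a b : ℂ) =
      3 * ((1 : MulChar (ZMod p) ℂ) a * (1 : MulChar (ZMod q) ℂ) b)
      + (if b = 0 then 4 else 0) - (χ ^ 2) a * (φ ^ 2) b
      + (-1 + Complex.I) * (χ a * φ b) + (-1 - Complex.I) * (χ⁻¹ a * φ⁻¹ b) := by
  obtain ⟨u, rfl, rfl⟩ := exists_natCast_eq_and hpq a b
  rw [twoPrimeValue_natCast]
  exact_mod_cast two_mul_twoPrimeQuaternary_val hpq hgcd hgp hgq hhp hhq hχ hφ u

theorem aeval_generatingPoly_twoPrimeQuaternary (hpq : p.Coprime q) (g h : ℤ) {R : Type*}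
    [CommRing R] (x : R) :
    aeval x (generatingPoly 4 (p * q) (twoPrimeQuaternary p q g h)) =
      ∑ u ∈ Finset.range (p * q), (twoPrimeValue hpq g h u u : R) * x ^ u := by
  simp only [generatingPoly, map_sum, map_mul, aeval_C, map_pow, aeval_X]
  refine Finset.sum_congr rfl fun u _ => ?_
  rw [twoPrimeValue_natCast]
  simp

theorem MulChar.sum_one_zmod : ∑ a : ZMod p, (1 : MulChar (ZMod p) ℂ) a = p - 1 := by
  rw [MulChar.sum_one_eq_card_units, ZMod.card_units, Nat.cast_sub (Fact.out : p.Prime).one_le,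
    Nat.cast_one]

theorem MulChar.one_apply_eq_ite (a : ZMod p) :
    (1 : MulChar (ZMod p) ℂ) a = if a = 0 then 0 else 1 := by
  split_ifs with ha
  · rw [ha, MulChar.map_zero]
  · exact MulChar.one_apply (Ne.isUnit ha)

/-- In the character expansion the nontrivial characters of `b` sum to zero, so only the indicator
terms remain. -/
theorem sum_twoPrimeValue_right (hpq : p.Coprime q)
    (hgcd : Nat.gcd (p - 1) (q - 1) = 4)
    (hgp : IsPrimitiveRootModPrime g p) (hgq : IsPrimitiveRootModPrime g q)
    (hhp : (h : ZMod p) = g) (hhq : (h : ZMod q) = 1)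
    (hχ : χ (g : ZMod p) = Complex.I) (hφ : φ (g : ZMod q) = -Complex.I) (h2 : φ ^ 2 ≠ 1)
    (a : ZMod p) :
    2 * ∑ b, twoPrimeValue hpq g h a b = 4 + if a = 0 then 0 else 3 * ((q : ℤ) - 1) := by
  have h1 : φ ≠ 1 := by rintro rfl; simp at h2
  have key : ((2 * ∑ b, twoPrimeValue hpq g h a b : ℤ) : ℂ) =
      4 + 3 * (1 : MulChar (ZMod p) ℂ) a * (q - 1) := by
    push_cast
    rw [Finset.mul_sum]
    simp_rw [two_mul_twoPrimeValue hpq hgcd hgp hgq hhp hhq hχ hφ]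
    simp only [Finset.sum_add_distrib, Finset.sum_sub_distrib, ← Finset.mul_sum,
      MulChar.sum_one_zmod, MulChar.sum_eq_zero_of_ne_one h1, MulChar.sum_eq_zero_of_ne_one h2,
      MulChar.sum_eq_zero_of_ne_one (inv_ne_one.2 h1)]
    simp
    ring
  rw [MulChar.one_apply_eq_ite] at key
  split_ifs at key ⊢
  · simp only [mul_zero, zero_mul] at key; exact_mod_cast key
  · rw [mul_one] at key; exact_mod_cast key

theorem sum_twoPrimeValue_left (hpq : p.Coprime q)
    (hgcd : Nat.gcd (p - 1) (q - 1) = 4)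
    (hgp : IsPrimitiveRootModPrime g p) (hgq : IsPrimitiveRootModPrime g q)
    (hhp : (h : ZMod p) = g) (hhq : (h : ZMod q) = 1)
    (hχ : χ (g : ZMod p) = Complex.I) (hφ : φ (g : ZMod q) = -Complex.I) (h2 : χ ^ 2 ≠ 1)
    (b : ZMod q) :
    2 * ∑ a, twoPrimeValue hpq g h a b = if b = 0 then 4 * (p : ℤ) else 3 * ((p : ℤ) - 1) := by
  have h1 : χ ≠ 1 := by rintro rfl; simp at h2
  have key : ((2 * ∑ a, twoPrimeValue hpq g h a b : ℤ) : ℂ) =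
      3 * ((p - 1) * (1 : MulChar (ZMod q) ℂ) b) + p * (if b = 0 then 4 else 0) := by
    push_cast
    rw [Finset.mul_sum]
    simp_rw [two_mul_twoPrimeValue hpq hgcd hgp hgq hhp hhq hχ hφ]
    simp only [Finset.sum_add_distrib, Finset.sum_sub_distrib, ← Finset.mul_sum, ← Finset.sum_mul,
      MulChar.sum_one_zmod, MulChar.sum_eq_zero_of_ne_one h1, MulChar.sum_eq_zero_of_ne_one h2,
      MulChar.sum_eq_zero_of_ne_one (inv_ne_one.2 h1)]
    simp
  rw [MulChar.one_apply_eq_ite] at key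
  split_ifs at key ⊢
  · simp only [mul_zero, zero_add] at key; rw [mul_comm 4]; exact_mod_cast key
  · simp only [mul_one, mul_zero, add_zero] at key; exact_mod_cast key

theorem four_pow_modEq_val {n : ℕ} (u : ℕ) :
    (4 : ℤ) ^ u ≡ 4 ^ (u : ZMod n).val [ZMOD 4 ^ n - 1] := by
  rw [ZMod.val_natCast]
  conv_lhs => rw [← Nat.mod_add_div u n, pow_add, pow_mul]
  have : (4 : ℤ) ^ n ≡ 1 [ZMOD 4 ^ n - 1] := (Int.modEq_sub _ _)
  simpa using (this.pow (u / n)).mul_left (4 ^ (u % n))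

theorem sum_four_pow_val (n : ℕ) [NeZero n] :
    ∑ a : ZMod n, (4 : ℤ) ^ a.val = ∑ k ∈ Finset.range n, 4 ^ k := by
  rw [← ZMod.sum_range_natCast]
  refine Finset.sum_congr rfl fun u hu => ?_
  rw [ZMod.val_cast_of_lt (by simpa using hu)]

/-- The generating polynomial at `4` modulo `4 ^ p - 1`. -/
theorem two_mul_eval_modEq_left (hpq : p.Coprime q)
    (hgcd : Nat.gcd (p - 1) (q - 1) = 4)
    (hgp : IsPrimitiveRootModPrime g p) (hgq : IsPrimitiveRootModPrime g q)
    (hhp : (h : ZMod p) = g) (hhq : (h : ZMod q) = 1)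
    (hχ : χ (g : ZMod p) = Complex.I) (hφ : φ (g : ZMod q) = -Complex.I) (h2 : φ ^ 2 ≠ 1) :
    2 * (generatingPoly 4 (p * q) (twoPrimeQuaternary p q g h)).eval 4 ≡
      (3 * q + 1) * ∑ k ∈ Finset.range p, 4 ^ k - 3 * (q - 1) [ZMOD 4 ^ p - 1] := by
  have e1 := aeval_generatingPoly_twoPrimeQuaternary hpq g h (4 : ℤ)
  rw [coe_aeval_eq_eval] at e1
  rw [e1, Finset.mul_sum]
  have e2 : ∑ u ∈ Finset.range (p * q), 2 * ((twoPrimeValue hpq g h u u : ℤ) * (4 : ℤ) ^ u) ≡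
      ∑ u ∈ Finset.range (p * q), 2 * (twoPrimeValue hpq g h u u * 4 ^ (u : ZMod p).val)
      [ZMOD 4 ^ p - 1] :=
    Int.ModEq.sum fun u _ => ((four_pow_modEq_val u).mul_left _).mul_left _
  refine e2.trans ?_
  rw [ZMod.sum_range_mul_natCast hpq
    (fun a b => 2 * (twoPrimeValue hpq g h a b * (4 : ℤ) ^ a.val)), ← sum_four_pow_val]
  have e3 (a : ZMod p) : ∑ b, 2 * (twoPrimeValue hpq g h a b * (4 : ℤ) ^ a.val) =
      (3 * q + 1) * 4 ^ a.val - if a = 0 then 3 * ((q : ℤ) - 1) else 0 := by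
    rw [← Finset.mul_sum, ← Finset.sum_mul, ← mul_assoc,
      sum_twoPrimeValue_right hpq hgcd hgp hgq hhp hhq hχ hφ h2]
    split_ifs with ha
    · rw [ha, ZMod.val_zero]; ring
    · ring
  simp_rw [e3, Finset.sum_sub_distrib, ← Finset.mul_sum]
  simp only [Finset.sum_ite_eq', Finset.mem_univ, if_true]
  exact Int.ModEq.rfl

/-- The generating polynomial at `4` modulo `4 ^ q - 1`. -/
theorem two_mul_eval_modEq_right (hpq : p.Coprime q)
    (hgcd : Nat.gcd (p - 1) (q - 1) = 4)
    (hgp : IsPrimitiveRootModPrime g p) (hgq : IsPrimitiveRootModPrime g q)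
    (hhp : (h : ZMod p) = g) (hhq : (h : ZMod q) = 1)
    (hχ : χ (g : ZMod p) = Complex.I) (hφ : φ (g : ZMod q) = -Complex.I) (h2 : χ ^ 2 ≠ 1) :
    2 * (generatingPoly 4 (p * q) (twoPrimeQuaternary p q g h)).eval 4 ≡
      p + 3 [ZMOD 4 ^ q - 1] := by
  have e1 := aeval_generatingPoly_twoPrimeQuaternary hpq g h (4 : ℤ)
  rw [coe_aeval_eq_eval] at e1
  rw [e1, Finset.mul_sum]
  have e2 : ∑ u ∈ Finset.range (p * q), 2 * ((twoPrimeValue hpq g h u u : ℤ) * (4 : ℤ) ^ u) ≡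
      ∑ u ∈ Finset.range (p * q), 2 * (twoPrimeValue hpq g h u u * 4 ^ (u : ZMod q).val)
      [ZMOD 4 ^ q - 1] :=
    Int.ModEq.sum fun u _ => ((four_pow_modEq_val u).mul_left _).mul_left _
  refine e2.trans ?_
  rw [ZMod.sum_range_mul_natCast hpq
    (fun a b => 2 * (twoPrimeValue hpq g h a b * (4 : ℤ) ^ b.val)), Finset.sum_comm]
  have e3 (b : ZMod q) : ∑ a, 2 * (twoPrimeValue hpq g h a b * (4 : ℤ) ^ b.val) =
      (3 * (p - 1)) * 4 ^ b.val + if b = 0 then (p : ℤ) + 3 else 0 := by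
    rw [← Finset.mul_sum, ← Finset.sum_mul, ← mul_assoc,
      sum_twoPrimeValue_left hpq hgcd hgp hgq hhp hhq hχ hφ h2]
    split_ifs with ha
    · rw [ha, ZMod.val_zero]; ring
    · ring
  simp_rw [e3, Finset.sum_add_distrib, ← Finset.mul_sum]
  rw [sum_four_pow_val]
  have e4 := geom_sum_mul (4 : ℤ) q
  -- The leftover `3(p-1) ∑ 4^k` equals `(p-1)(4^q-1)`.
  refine (Int.modEq_iff_dvd.2 ⟨-(p - 1), ?_⟩)
  simp only [Finset.sum_ite_eq', Finset.mem_univ, if_true]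
  linear_combination (-(p : ℤ) + 1) * e4

/-- The sum of the values against an additive character. -/
theorem two_mul_sum_twoPrimeValue_addChar (hpq : p.Coprime q)
    (hgcd : Nat.gcd (p - 1) (q - 1) = 4)
    (hgp : IsPrimitiveRootModPrime g p) (hgq : IsPrimitiveRootModPrime g q)
    (hhp : (h : ZMod p) = g) (hhq : (h : ZMod q) = 1)
    (hχ : χ (g : ZMod p) = Complex.I) (hφ : φ (g : ZMod q) = -Complex.I)
    {ψ : AddChar (ZMod p) ℂ} {θ : AddChar (ZMod q) ℂ} (hψ : ψ ≠ 1) (hθ : θ ≠ 1) :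
    2 * ∑ a, ∑ b, (twoPrimeValue hpq g h a b : ℂ) * (ψ a * θ b) =
      3 - gaussSum (χ ^ 2) ψ * gaussSum (φ ^ 2) θ +
      ((-1 + Complex.I) * (gaussSum χ ψ * gaussSum φ θ) +
        (-1 - Complex.I) * (gaussSum χ⁻¹ ψ * gaussSum φ⁻¹ θ)) := by
  have hprod (α : MulChar (ZMod p) ℂ) (α' : MulChar (ZMod q) ℂ) :
      ∑ a, ∑ b, α a * α' b * (ψ a * θ b) = gaussSum α ψ * gaussSum α' θ := by
    simp only [gaussSum, Finset.sum_mul_sum]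
    exact Finset.sum_congr rfl fun a _ => Finset.sum_congr rfl fun b _ => by ring
  have hzero : ∑ a, ∑ b, (if b = 0 then (4 : ℂ) else 0) * (ψ a * θ b) = 0 := by
    simp only [ite_mul, zero_mul, Finset.sum_ite_eq', Finset.mem_univ, if_true, ← Finset.mul_sum,
      ← Finset.sum_mul, AddChar.sum_eq_zero_of_ne_one hψ, mul_zero]
  have hexp (a : ZMod p) (b : ZMod q) :
      2 * ((twoPrimeValue hpq g h a b : ℂ) * (ψ a * θ b)) =
        3 * ((1 : MulChar (ZMod p) ℂ) a * (1 : MulChar (ZMod q) ℂ) b * (ψ a * θ b))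
        + (if b = 0 then (4 : ℂ) else 0) * (ψ a * θ b) - (χ ^ 2) a * (φ ^ 2) b * (ψ a * θ b)
        + (-1 + Complex.I) * (χ a * φ b * (ψ a * θ b))
        + (-1 - Complex.I) * (χ⁻¹ a * φ⁻¹ b * (ψ a * θ b)) := by
    rw [← mul_assoc, two_mul_twoPrimeValue hpq hgcd hgp hgq hhp hhq hχ hφ]
    ring
  simp only [Finset.mul_sum, hexp]
  simp only [Finset.sum_add_distrib, Finset.sum_sub_distrib, ← Finset.mul_sum, hprod, hzero,
    gaussSum_one_left hψ, gaussSum_one_left hθ]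
  ring

/-- This carries an identity at a complex root of unity over to a divisibility of integer
polynomials, hence to one at 4. -/
theorem cyclotomic_dvd_of_aeval_eq_zero {n : ℕ} (hn : 0 < n) {ζ : ℂ} (hζ : IsPrimitiveRoot ζ n)
    {F : ℤ[X]} (hF : aeval ζ F = 0) : cyclotomic n ℤ ∣ F := by
  rw [cyclotomic_eq_minpoly hζ hn]
  exact minpoly.isIntegrallyClosed_dvd (hζ.isIntegral hn) hF

/-- Divisibility by `Φ_pq(4)` obtained from the quartic Gauss sums. -/
theorem exists_cyclotomic_eval_dvd (hpq : p.Coprime q)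
    (hgcd : Nat.gcd (p - 1) (q - 1) = 4)
    (hgp : IsPrimitiveRootModPrime g p) (hgq : IsPrimitiveRootModPrime g q)
    (hhp : (h : ZMod p) = g) (hhq : (h : ZMod q) = 1)
    (hχ : χ (g : ZMod p) = Complex.I) (hφ : φ (g : ZMod q) = -Complex.I)
    (h4 : χ ^ 4 = 1) (h2 : χ ^ 2 ≠ 1) (h4' : φ ^ 4 = 1) (h2' : φ ^ 2 ≠ 1)
    {ε : ℤ} (hε : χ (-1) * φ (-1) = ε) :
    ∃ β γ : ℤ, β ^ 2 ≤ p * q ∧ (cyclotomic (p * q) ℤ).eval 4 ∣ γ ^ 2 - p * q ∧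
      (cyclotomic (p * q) ℤ).eval 4 ∣
        (2 * (generatingPoly 4 (p * q) (twoPrimeQuaternary p q g h)).eval 4 - 3 + γ) ^ 2
          - 4 * β * γ - 4 * ε * (p * q) := by
  have hp0 := (Fact.out : p.Prime).ne_zero
  have hq0 := (Fact.out : q.Prime).ne_zero
  have hζp := Complex.isPrimitiveRoot_exp p hp0
  have hζq := Complex.isPrimitiveRoot_exp q hq0
  generalize Complex.exp (2 * Real.pi * Complex.I / p) = ζ₁ at hζp
  generalize Complex.exp (2 * Real.pi * Complex.I / q) = ζ₂ at hζq
  have hψ := AddChar.zmodChar_primitive_of_primitive_root p hζp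
  have hθ := AddChar.zmodChar_primitive_of_primitive_root q hζq
  have hψu : ∀ u : ℕ, AddChar.zmodChar p hζp.pow_eq_one (u : ZMod p) = ζ₁ ^ u :=
    fun u => AddChar.zmodChar_apply' _ u
  have hθu : ∀ u : ℕ, AddChar.zmodChar q hζq.pow_eq_one (u : ZMod q) = ζ₂ ^ u :=
    fun u => AddChar.zmodChar_apply' _ u
  have hψ1 : AddChar.zmodChar p hζp.pow_eq_one ≠ 1 := by simpa using hψ one_ne_zero
  have hθ1 : AddChar.zmodChar q hζq.pow_eq_one ≠ 1 := by simpa using hθ one_ne_zero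
  generalize AddChar.zmodChar p hζp.pow_eq_one = ψ at *
  generalize AddChar.zmodChar q hζq.pow_eq_one = θ at *
  have hζ : IsPrimitiveRoot (ζ₁ * ζ₂) (p * q) := by
    rw [IsPrimitiveRoot.iff_orderOf,
      (Commute.all ζ₁ ζ₂).orderOf_mul_eq_mul_orderOf_of_coprime, ← hζp.eq_orderOf,
      ← hζq.eq_orderOf]
    rwa [← hζp.eq_orderOf, ← hζq.eq_orderOf]
  have hu (u : ℕ) : (ζ₁ * ζ₂) ^ u = ψ u * θ u := by rw [hψu, hθu, mul_pow]
  obtain ⟨β, hβ, hrel⟩ := quartic_gaussSum_product_relation h4 h2 h4' h2' hψ hθ hε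
  choose c hc using exists_int_quartic_sq h4
  choose d hd using exists_int_quartic_sq h4'
  -- An integer polynomial whose value at `ζ₁ * ζ₂` is the product of the quadratic Gauss sums; `γ`
  -- will be its value at 4.
  let Γ : ℤ[X] := ∑ u ∈ Finset.range (p * q), C (c (u : ZMod p) * d (u : ZMod q)) * X ^ u
  have hΓ : aeval (ζ₁ * ζ₂) Γ = gaussSum (χ ^ 2) ψ * gaussSum (φ ^ 2) θ := by
    simp only [Γ, map_sum, map_mul, map_pow, aeval_X, aeval_C]
    simp only [eq_intCast, hc, hd, hu]
    rw [ZMod.sum_range_mul_natCast hpq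
      (fun a b => (χ ^ 2) a * (φ ^ 2) b * (ψ a * θ b))]
    simp only [gaussSum, Finset.sum_mul_sum]
    exact Finset.sum_congr rfl fun a _ => Finset.sum_congr rfl fun b _ => by ring
  have hE := aeval_generatingPoly_twoPrimeQuaternary hpq g h (ζ₁ * ζ₂)
  simp_rw [hu] at hE
  rw [ZMod.sum_range_mul_natCast hpq
    (fun a b => (twoPrimeValue hpq g h a b : ℂ) * (ψ a * θ b))] at hE
  have hE2 := two_mul_sum_twoPrimeValue_addChar hpq hgcd hgp hgq hhp hhq hχ hφ hψ1 hθ1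
  rw [← hE, ← hΓ] at hE2
  rw [← hΓ] at hrel
  have hsq : (aeval (ζ₁ * ζ₂) Γ) ^ 2 = (p * q : ℂ) := by
    rw [hΓ, mul_pow, gaussSum_quartic_sq_sq h4 h2 hψ, gaussSum_quartic_sq_sq h4' h2' hθ]
  have hpos : 0 < p * q := by positivity
  set S := generatingPoly 4 (p * q) (twoPrimeQuaternary p q g h)
  have d1 : cyclotomic (p * q) ℤ ∣ Γ ^ 2 - C ((p : ℤ) * q) :=
    cyclotomic_dvd_of_aeval_eq_zero hpos hζ (by
      simp only [map_sub, map_pow, aeval_C, hsq]; simp)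
  have d2 : cyclotomic (p * q) ℤ ∣
      (C 2 * S - C 3 + Γ) ^ 2 - C (4 * β) * Γ - C (4 * ε * (p * q)) :=
    cyclotomic_dvd_of_aeval_eq_zero hpos hζ (by
      simp only [map_sub, map_pow, aeval_C, map_add, map_mul]
      simp only [eq_intCast, Int.cast_ofNat, hE2, Int.cast_natCast]
      linear_combination hrel)
  refine ⟨β, Γ.eval 4, hβ, ?_, ?_⟩
  · simpa using eval_dvd (x := (4 : ℤ)) d1
  · have := eval_dvd (x := (4 : ℤ)) d2
    simpa only [eval_sub, eval_pow, eval_add, eval_mul, eval_C] using this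

end

/-! ### Quartic characters determined by their value at a primitive root. -/

theorem MulChar.pow_four_eq_one_of_apply {p : ℕ} [Fact p.Prime] {γ : ZMod p}
    (hγ : orderOf γ = p - 1) {χ : MulChar (ZMod p) ℂ} (hχ : χ γ ^ 2 = -1) : χ ^ 4 = 1 := by
  ext a
  obtain ⟨m, hm⟩ := ZMod.exists_eq_pow_of_orderOf_eq hγ a.ne_zero
  rw [MulChar.pow_apply_coe, MulChar.one_apply_coe, hm, map_pow, ← pow_mul, mul_comm, pow_mul,
    show χ γ ^ 4 = (χ γ ^ 2) ^ 2 by ring, hχ]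
  norm_num

theorem MulChar.sq_ne_one_of_apply {p : ℕ} [Fact p.Prime] {γ : ZMod p}
    {χ : MulChar (ZMod p) ℂ} (hχ : χ γ ^ 2 = -1) : χ ^ 2 ≠ 1 := by
  intro h
  rw [← MulChar.pow_apply' χ (by norm_num), h, MulChar.one_apply_eq_ite] at hχ
  split_ifs at hχ <;> norm_num at hχ

/-- Since `-1 = γ^((p-1)/2)` and `χ(γ)² = -1`, the value is `(-1)^((p-1)/4)`. -/
theorem MulChar.apply_neg_one_of_apply {p : ℕ} [Fact p.Prime] {γ : ZMod p}
    (hγ : orderOf γ = p - 1) {χ : MulChar (ZMod p) ℂ} (hχ : χ γ ^ 2 = -1) (hp : p % 4 = 1) :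
    χ (-1) = ((if p % 8 = 1 then 1 else -1 : ℤ) : ℂ) := by
  have hp2 := (Fact.out : p.Prime).two_le
  have hneg : γ ^ ((p - 1) / 2) = -1 := by
    have h1 : (γ ^ ((p - 1) / 2)) ^ 2 = 1 := by
      rw [← pow_mul, Nat.div_mul_cancel (by omega), ← hγ, pow_orderOf_eq_one]
    rcases eq_or_eq_neg_of_sq_eq_sq (γ ^ ((p - 1) / 2)) 1
        (h1.trans (one_pow 2).symm) with h | h
    · have := orderOf_dvd_of_pow_eq_one h
      rw [hγ] at this
      have := Nat.le_of_dvd (by omega) this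
      omega
    · exact h
  rw [← hneg, map_pow, show (p - 1) / 2 = 2 * ((p - 1) / 4) by omega, pow_mul, hχ]
  split_ifs with h8
  · rw [Even.neg_one_pow ⟨(p - 1) / 8, by omega⟩]; simp
  · rw [Odd.neg_one_pow ⟨(p - 1) / 8, by omega⟩]; simp

/-! ### Prime divisors of `4^n - 1` and the order of 4. -/

theorem four_pow_eq_one_iff_dvd {l n : ℕ} : (4 : ZMod l) ^ n = 1 ↔ (l : ℤ) ∣ 4 ^ n - 1 := by
  rw [← ZMod.intCast_zmod_eq_zero_iff_dvd, ← sub_eq_zero]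
  push_cast
  rfl

/-- The order of 4 mod `l` is 1, forcing `l ∣ 3`, or `p`, which then divides `l - 1`. -/
theorem eq_three_or_dvd_sub_one {l p : ℕ} (hl : l.Prime) (hp : p.Prime)
    (h : (l : ℤ) ∣ 4 ^ p - 1) : l = 3 ∨ p ∣ l - 1 := by
  have := Fact.mk hl
  have h4 := four_pow_eq_one_iff_dvd.2 h
  rcases (Nat.dvd_prime hp).1 (orderOf_dvd_of_pow_eq_one h4) with h1 | h1
  · left
    have : (4 : ZMod l) ^ 1 = 1 := by rw [← h1, pow_orderOf_eq_one]
    have := four_pow_eq_one_iff_dvd.1 this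
    norm_num at this
    exact (Nat.prime_dvd_prime_iff_eq hl Nat.prime_three).1 (by exact_mod_cast this)
  · right
    rw [← h1]
    refine ZMod.orderOf_dvd_card_sub_one ?_
    intro h0
    rw [h0, zero_pow hp.ne_zero] at h4
    exact zero_ne_one h4

theorem mul_dvd_sub_one {l p q : ℕ} (hl : l.Prime) (hp : p.Prime) (hq : q.Prime)
    (h : (l : ℤ) ∣ 4 ^ (p * q) - 1) (hlp : ¬ (l : ℤ) ∣ 4 ^ p - 1) (hlq : ¬ (l : ℤ) ∣ 4 ^ q - 1) :
    p * q ∣ l - 1 := by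
  have := Fact.mk hl
  have h4 := four_pow_eq_one_iff_dvd.2 h
  rw [← four_pow_eq_one_iff_dvd] at hlp hlq
  have h40 : (4 : ZMod l) ≠ 0 := by
    intro h0
    rw [h0, zero_pow (mul_ne_zero hp.ne_zero hq.ne_zero)] at h4
    exact zero_ne_one h4
  have hcard := ZMod.orderOf_dvd_card_sub_one h40
  obtain ⟨a, b, ha, hb, hab⟩ := (Nat.dvd_mul).1 (orderOf_dvd_of_pow_eq_one h4)
  rcases (Nat.dvd_prime hp).1 ha with rfl | rfl
  · refine absurd ?_ hlq
    rw [← orderOf_dvd_iff_pow_eq_one, ← hab, one_mul]; exact hb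
  · rcases (Nat.dvd_prime hq).1 hb with rfl | rfl
    · refine absurd ?_ hlp
      rw [← orderOf_dvd_iff_pow_eq_one, ← hab, mul_one]
    · rwa [hab]

theorem Nat.modEq_one_of_forall_prime_dvd {N n : ℕ} (hn : n ≠ 0)
    (h : ∀ l : ℕ, l.Prime → l ∣ n → l ≡ 1 [MOD N]) : n ≡ 1 [MOD N] := by
  induction n using Nat.recOnMul with
  | zero => exact absurd rfl hn
  | one => rfl
  | prime l hl => exact h l hl dvd_rfl
  | mul a b ha hb =>
    have := (ha (left_ne_zero_of_mul hn) fun l hl hd => h l hl (hd.mul_right b)).mul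
      (hb (right_ne_zero_of_mul hn) fun l hl hd => h l hl (hd.mul_left a))
    simpa using this

/-! ### Size estimates for a divisor `1 + 2Nt`. -/

/-- `j` with `j + 2t(Nj - 81) = (4β + 6)² - r` extracted from a divisibility by `1 + 2Nt`. -/
theorem exists_cofactor {N t W c r : ℤ} (hN : N % 4 = 1)
    (hW : W = N * c - 81 - N * r) (h4 : 4 ∣ W) (hdvd : 1 + 2 * N * t ∣ W) :
    ∃ j : ℤ, j % 4 = 1 ∧ j + 2 * t * (N * j - 81) = c - r := by
  have hcop : IsCoprime (4 : ℤ) (1 + 2 * N * t) :=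
    ⟨(N * t) ^ 2, 1 - 2 * N * t, by ring⟩
  obtain ⟨m, hm⟩ := hcop.mul_dvd h4 hdvd
  -- With `W = 4m(1 + 2Nt)`, reduction mod `N` gives `4m ≡ -81`; `j` is the quotient of `4m + 81` by
  -- `N`.
  have hj : 4 * m + 81 = N * (c - r - 8 * t * m) := by
    linear_combination hW - hm
  refine ⟨c - r - 8 * t * m, ?_, ?_⟩
  · generalize c - r - 8 * t * m = j at *
    have h1 : (N * j) % 4 = 1 := by omega
    rw [Int.mul_emod, hN] at h1
    omega
  · rw [← hj]; ring

/-- For `t ≤ 7` the product is about `14Nq/4` at most, below `4Nq`; larger `t` needs the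
divisibility relation. -/
theorem mul_lt_of_le_seven {d q N t : ℤ} (hd : 4 * d ≤ q - 1) (hd0 : 0 < d)
    (ht : t ≤ 7) (hN : 65 ≤ N) : d * (1 + 2 * N * t) < 4 * N * q := by
  have h1 : 1 + 2 * N * t ≤ 1 + 14 * N := by nlinarith
  have h2 : d * (1 + 2 * N * t) ≤ d * (1 + 14 * N) := mul_le_mul_of_nonneg_left h1 hd0.le
  have h3 : 4 * d * (1 + 14 * N) ≤ (q - 1) * (1 + 14 * N) :=
    mul_le_mul_of_nonneg_right hd (by linarith)
  nlinarith

/-- This is the case `ε = 1`. For `t ≥ 8`, size leaves only `j = 1`, so `1 + 2t(N - 81)` is at most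
`9N + 378`. This bounds `t` unless `N < 81`, that is `N = 65`, which is treated separately. -/
theorem mul_lt_of_dvd_pos {p q d : ℕ} {β t : ℤ} (hp : p % 8 = 5) (hq : q % 8 = 5)
    (hqp : q.Prime) (hpq : p < q) (hβ : β ^ 2 ≤ p * q) (hd0 : 0 < d) (hd : 4 * d ≤ q - 1)
    (hd1 : d = 1 ∨ 11 ≤ d) (ht : 0 ≤ t)
    (hdvd : 1 + 2 * ((p : ℤ) * q) * t ∣ p * q * (4 * β + 6) ^ 2 - (9 - 3 * (p * q)) ^ 2) :
    (d : ℤ) * (1 + 2 * ((p : ℤ) * q) * t) < 4 * (p * q) * q := by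
  -- The composites 21 and 45 are 5 mod 8; excluding them raises the lower bounds to `N ≥ 145` for
  -- `N ≠ 65`, and to `q ≥ 53` once `q ≥ 45`.
  have hq21 : q ≠ 21 := by rintro rfl; norm_num at hqp
  have hq45 : q ≠ 45 := by rintro rfl; norm_num at hqp
  have hN8 : ((p : ℤ) * q) % 8 = 1 := by
    rw [Int.mul_emod, show (p : ℤ) % 8 = 5 by omega, show (q : ℤ) % 8 = 5 by omega]; rfl
  have hN : (p = 5 ∧ q = 13) ∨ (145 ≤ (p : ℤ) * q ∧ (53 ≤ q → 265 ≤ (p : ℤ) * q)) := by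
    by_cases h5 : p = 5
    · by_cases h13 : q = 13
      · exact Or.inl ⟨h5, h13⟩
      · right; subst h5; push_cast; omega
    · right
      have h1 : (13 : ℤ) ≤ p := by omega
      have h2 : (21 : ℤ) ≤ q := by omega
      constructor
      · nlinarith
      · intro _; nlinarith
  have hN65 : 65 ≤ (p : ℤ) * q := by
    rcases hN with ⟨rfl, rfl⟩ | h
    · norm_num
    · linarith [h.1]
  have hq13 : (13 : ℤ) ≤ q := by omega
  generalize hNdef : (p : ℤ) * q = N at *
  obtain ⟨j, hj4, hj⟩ := exists_cofactor (N := N) (t := t) (c := (4 * β + 6) ^ 2)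
    (r := 9 * N - 54) (by omega) (by ring)
    (by
      obtain ⟨k, hk⟩ : ∃ k, N = 2 * k + 1 := ⟨N / 2, by omega⟩
      exact ⟨N * (2 * β + 3) ^ 2 - (3 - 3 * k) ^ 2, by rw [hk]; ring⟩) hdvd
  have hc0 : 0 ≤ (4 * β + 6) ^ 2 := sq_nonneg _
  -- Uses `48β ≤ 2β² + 288`, i.e. `2(β - 12)² ≥ 0`, and `β² ≤ N`.
  have hc : (4 * β + 6) ^ 2 ≤ 18 * N + 324 := by nlinarith [sq_nonneg (β - 12)]
  have hd' : 4 * (d : ℤ) ≤ q - 1 := by omega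
  have hd0' : 0 < (d : ℤ) := by omega
  by_cases ht7 : t ≤ 7
  · exact mul_lt_of_le_seven hd' hd0' ht7 hN65
  push Not at ht7
  have hj1 : j = 1 := by
    by_contra hne
    rcases lt_or_ge j 1 with h | h
    · have h1 : j ≤ -3 := by omega
      have h2 : N * j ≤ N * -3 := mul_le_mul_of_nonneg_left h1 (by linarith)
      have h3 : t * (N * j) ≤ t * (N * -3) := mul_le_mul_of_nonneg_left h2 ht
      have h4 : 8 * N ≤ t * N := mul_le_mul_of_nonneg_right (by omega) (by linarith)
      nlinarith
    · have h1 : 5 ≤ j := by omega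
      have h2 : N * 5 ≤ N * j := mul_le_mul_of_nonneg_left h1 (by linarith)
      have h3 : t * (N * 5 - 81) ≤ t * (N * j - 81) := mul_le_mul_of_nonneg_left (by linarith) ht
      have h4 : 8 * (N * 5 - 81) ≤ t * (N * 5 - 81) :=
        mul_le_mul_of_nonneg_right (by omega) (by linarith)
      nlinarith
  subst hj1
  rcases hN with ⟨rfl, rfl⟩ | ⟨hN1, hN2⟩
  -- Here `N - 81 = -16`; nonnegativity of the square gives `32t ≤ 532`, and `4d ≤ 12` leaves only
  -- `d = 1`.
  · have : N = 65 := by rw [← hNdef]; norm_num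
    subst this
    have hd1 : d = 1 := by omega
    subst hd1
    push_cast
    linarith
  · have h4 : 8 * (N - 81) ≤ t * (N - 81) := mul_le_mul_of_nonneg_right (by omega) (by linarith)
    -- If `d ≥ 11` then `q ≥ 45`, so `N ≥ 265`, whereas `16(N - 81) < 9N + 378` forces `N < 240`.
    have hd1 : d = 1 := by
      rcases hd1 with h | h
      · exact h
      · have := hN2 (by omega)
        nlinarith
    subst hd1
    by_contra hcon
    push Not at hcon
    -- Failure of the bound with `q ≥ 13` means `1 + 2Nt ≥ 52N`; then `52(N - 81) < 9N + 378`
    -- contradicts `N ≥ 145`.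
    have h5 : 26 ≤ t := by
      by_contra h26
      have : N * t ≤ N * 25 := mul_le_mul_of_nonneg_left (by omega) (by linarith)
      push_cast at hcon
      nlinarith
    have h6 : 26 * (N - 81) ≤ t * (N - 81) := mul_le_mul_of_nonneg_right h5 (by linarith)
    nlinarith

/-- This is the case `ε = -1`. Now `c - r ≤ 234 - 7N` is negative, which rules out `j ≥ 1`; and `j ≤
-3` makes the left side too negative once `t ≥ 8`. -/
theorem mul_lt_of_dvd_neg {p q d : ℕ} {β t : ℤ} (hN8 : ((p : ℤ) * q) % 8 = 5)
    (hN85 : 85 ≤ (p : ℤ) * q) (hβ : β ^ 2 ≤ p * q) (hd0 : 0 < d) (hd : 4 * d ≤ q - 1)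
    (ht : 0 ≤ t)
    (hdvd : 1 + 2 * ((p : ℤ) * q) * t ∣ p * q * (4 * β + 6) ^ 2 - (9 + 5 * (p * q)) ^ 2) :
    (d : ℤ) * (1 + 2 * ((p : ℤ) * q) * t) < 4 * (p * q) * q := by
  generalize (p : ℤ) * q = N at *
  obtain ⟨j, hj4, hj⟩ := exists_cofactor (N := N) (t := t) (c := (4 * β + 6) ^ 2)
    (r := 25 * N + 90) (by omega) (by ring)
    (by
      obtain ⟨k, hk⟩ : ∃ k, N = 2 * k + 1 := ⟨N / 2, by omega⟩
      exact ⟨N * (2 * β + 3) ^ 2 - (7 + 5 * k) ^ 2, by rw [hk]; ring⟩) hdvd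
  have hc0 : 0 ≤ (4 * β + 6) ^ 2 := sq_nonneg _
  have hc : (4 * β + 6) ^ 2 ≤ 18 * N + 324 := by nlinarith [sq_nonneg (β - 12)]
  refine mul_lt_of_le_seven (by omega) (by omega) ?_ (by linarith)
  by_contra ht7
  rcases lt_or_ge j 1 with h | h
  · have h1 : j ≤ -3 := by omega
    have h2 : N * j ≤ N * -3 := mul_le_mul_of_nonneg_left h1 (by linarith)
    have h3 : t * (N * j) ≤ t * (N * -3) := mul_le_mul_of_nonneg_left h2 ht
    have h4 : 8 * N ≤ t * N := mul_le_mul_of_nonneg_right (by omega) (by linarith)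
    nlinarith
  · have h2 : N * 1 ≤ N * j := mul_le_mul_of_nonneg_left h (by linarith)
    have h3 : 0 ≤ t * (N * j - 81) := mul_nonneg ht (by linarith)
    nlinarith

/-! ### The bound on the gcd. -/

/-- Everything comes from `Φ_q(X^p) = Φ_pq(X) Φ_q(X)` at 4. As `4^p ≡ 1` mod `4^p - 1`, the product
is congruent to `Φ_q(1) = q`, so only the prime `q` can divide both `4^p - 1` and `Φ_pq(4)`. -/
theorem four_pow_sub_one_factor {p q : ℕ} [Fact p.Prime] [Fact q.Prime] (hpq : p ≠ q) :
    (4 : ℤ) ^ (p * q) - 1 =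
      (4 ^ p - 1) * ((cyclotomic (p * q) ℤ).eval 4 * (cyclotomic q ℤ).eval 4) ∧
    (cyclotomic q ℤ).eval 4 * 3 = 4 ^ q - 1 ∧
    (4 : ℤ) ^ p - 1 ∣ (cyclotomic (p * q) ℤ).eval 4 * (cyclotomic q ℤ).eval 4 - q := by
  have hp := (Fact.out : p.Prime)
  have hq := (Fact.out : q.Prime)
  have hexp := cyclotomic_expand_eq_cyclotomic_mul hp (n := q)
    (fun h => hpq ((Nat.prime_dvd_prime_iff_eq hp hq).1 h)) ℤ
  have h1 := congrArg (eval 4) hexp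
  rw [expand_eval, eval_mul, mul_comm q p] at h1
  have hX (x : ℤ) : (cyclotomic q ℤ).eval x * (x - 1) = x ^ q - 1 := by
    simpa using congrArg (eval x) (cyclotomic_prime_mul_X_sub_one ℤ q)
  refine ⟨?_, by simpa using hX 4, ?_⟩
  · rw [← h1, mul_comm (_ - 1), hX, pow_mul]
  · rw [← h1]
    have := sub_dvd_eval_sub ((4 : ℤ) ^ p) 1 (cyclotomic q ℤ)
    rwa [eval_one_cyclotomic_prime] at this

/-- An upper bound for `gcd (S, 4 ^ (pq) - 1)` from the residues of `S` modulo `4 ^ p - 1` and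
`4 ^ q - 1` and a relation modulo `Φ_pq(4)`. -/
theorem gcd_four_pow_sub_one_lt {p q : ℕ} [Fact p.Prime] [Fact q.Prime]
    (hp4 : p % 4 = 1) (hq4 : q % 4 = 1) (h8 : ¬ (p % 8 = 1 ∧ q % 8 = 1)) (hpq : p < q) {S ε : ℤ}
    (hA : 2 * S ≡ (3 * q + 1) * ∑ k ∈ Finset.range p, 4 ^ k - 3 * (q - 1) [ZMOD 4 ^ p - 1])
    (hB : 2 * S ≡ p + 3 [ZMOD 4 ^ q - 1])
    (hε : ε = (if p % 8 = 1 then 1 else -1) * (if q % 8 = 1 then 1 else -1))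
    (hC : ∃ β γ : ℤ, β ^ 2 ≤ p * q ∧ (cyclotomic (p * q) ℤ).eval 4 ∣ γ ^ 2 - p * q ∧
      (cyclotomic (p * q) ℤ).eval 4 ∣
        (2 * S - 3 + γ) ^ 2 - 4 * β * γ - 4 * ε * (p * q)) :
    (Int.gcd S (4 ^ (p * q) - 1) : ℤ) < 4 * (p * q) * q := by
  have hp := (Fact.out : p.Prime)
  have hq := (Fact.out : q.Prime)
  have hp5 : 5 ≤ p := by have := hp.two_le; omega
  have hq9 : q ≠ 9 := by rintro rfl; norm_num at hq
  have hq13 : 13 ≤ q := by omega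
  obtain ⟨hfac, hK, hmod⟩ := four_pow_sub_one_factor (p := p) (q := q) hpq.ne
  obtain ⟨β, γ, hβ, hγ, hrel⟩ := hC
  set Φ := (cyclotomic (p * q) ℤ).eval 4
  set K := (cyclotomic q ℤ).eval 4
  have hgeom := geom_sum_mul (4 : ℤ) p
  set A' := ∑ k ∈ Finset.range p, (4 : ℤ) ^ k
  have hAM : (4 : ℤ) ^ p - 1 ∣ 4 ^ (p * q) - 1 := ⟨_, hfac⟩
  have h3B : (3 : ℤ) ∣ 4 ^ q - 1 := ⟨K, by rw [← hK]; ring⟩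
  -- prime divisors of the gcd
  have hoddM : ¬ (2 : ℤ) ∣ 4 ^ (p * q) - 1 := by
    have : (2 : ℤ) ∣ 4 ^ (p * q) :=
      dvd_pow (by norm_num) (mul_ne_zero hp.ne_zero hq.ne_zero)
    omega
  -- Such an `l` divides `p + 3`. It is not 3, as `p` is a prime other than 3; so `l ≥ q + 1`, which
  -- exceeds `p + 3` because `q ≥ p + 4`.
  have hprB : ∀ l : ℕ, l.Prime → (l : ℤ) ∣ S → ¬ (l : ℤ) ∣ 4 ^ q - 1 := by
    intro l hl hlS hlB
    have h1 : (l : ℤ) ∣ p + 3 := by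
      have := (hB.of_dvd hlB).symm.dvd
      have h2 : (l : ℤ) ∣ 2 * S := hlS.mul_left 2
      exact (dvd_sub_right h2).1 this
    have h2 : l ∣ p + 3 := by exact_mod_cast h1
    rcases eq_three_or_dvd_sub_one hl hq hlB with rfl | h3
    · have h4 : 3 ∣ p := (Nat.dvd_add_left (dvd_refl 3)).1 h2
      have := (Nat.prime_dvd_prime_iff_eq Nat.prime_three hp).1 h4
      omega
    · have h4 := Nat.le_of_dvd (by omega) h2
      have h5 := Nat.le_of_dvd (by have := hl.two_le; omega) h3
      omega
  have hpr3 : ¬ (3 : ℤ) ∣ S := fun h => hprB 3 Nat.prime_three (by exact_mod_cast h)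
    (by exact_mod_cast h3B)
  have hsubA {x : ℤ} (hxS : x ∣ S) (hxA : x ∣ 4 ^ p - 1) (hx3 : IsCoprime x 3) :
      x ∣ (q : ℤ) - 1 := by
    have h1 : x ∣ A' := hx3.dvd_of_dvd_mul_right (by rw [show A' * 3 = 4 ^ p - 1 by linarith]; exact hxA)
    have h2 := (hA.of_dvd hxA).symm.dvd
    have h3 : x ∣ 3 * ((q : ℤ) - 1) := by
      have e : 3 * ((q : ℤ) - 1) = (2 * S - ((3 * q + 1) * A' - 3 * (q - 1))) - 2 * S
        + (3 * q + 1) * A' := by ring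
      rw [e]
      exact ((h2.sub (hxS.mul_left 2))).add (h1.mul_left _)
    exact hx3.dvd_of_dvd_mul_left h3
  -- the part in `4 ^ p - 1`
  obtain ⟨d, hd⟩ : ∃ d : ℕ, d = Int.gcd S (4 ^ p - 1) := ⟨_, rfl⟩
  have hdS : (d : ℤ) ∣ S := hd ▸ Int.gcd_dvd_left ..
  have hdA : (d : ℤ) ∣ 4 ^ p - 1 := hd ▸ Int.gcd_dvd_right ..
  have hd3 : ¬ 3 ∣ d := fun h => hpr3 ((Int.natCast_dvd_natCast.2 h).trans hdS)
  have hd2 : ¬ 2 ∣ d := fun h => hoddM ((Int.natCast_dvd_natCast.2 h).trans (hdA.trans hAM))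
  have hc3 : ∀ {x : ℕ}, ¬ 3 ∣ x → IsCoprime (x : ℤ) 3 := fun {x} h => by
    have := ((Nat.Prime.coprime_iff_not_dvd Nat.prime_three).2 h).symm
    exact_mod_cast Nat.isCoprime_iff_coprime.2 this
  have hdq : d ∣ q - 1 := by
    have := hsubA hdS hdA (hc3 hd3)
    zify [hq.one_le]
    exact this
  have h4dq : 4 * d ∣ q - 1 := by
    refine Nat.Coprime.mul_dvd_of_dvd_of_dvd ?_ (by omega) hdq
    have := (Nat.Prime.coprime_iff_not_dvd Nat.prime_two).2 hd2
    exact Nat.Coprime.pow_left 2 this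
  have hd4 : 4 * d ≤ q - 1 := Nat.le_of_dvd (by omega) h4dq
  have hd0 : 0 < d := Nat.pos_of_ne_zero (by rintro rfl; simp at hd2)
  -- A prime factor of `d` is odd and not 3, hence 1 mod `2p`, and `2p + 1 ≥ 11`.
  have hd1 : d = 1 ∨ 11 ≤ d := by
    by_cases h1 : d = 1
    · exact Or.inl h1
    · right
      obtain ⟨l, hl, hld⟩ := Nat.exists_prime_and_dvd h1
      have hl2 : ¬ 2 ∣ l := fun h => hd2 (h.trans hld)
      rcases eq_three_or_dvd_sub_one hl hp ((Int.natCast_dvd_natCast.2 hld).trans hdA) with rfl | h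
      · exact absurd hld hd3
      · have h2p : 2 * p ∣ l - 1 := by
          refine Nat.Coprime.mul_dvd_of_dvd_of_dvd ?_ (by omega) h
          exact (Nat.coprime_primes Nat.prime_two hp).2 (by omega)
        have := Nat.le_of_dvd (by have := hl.two_le; omega) h2p
        have := Nat.le_of_dvd hd0 hld
        omega
  -- the part in `Φ`
  obtain ⟨n, hn⟩ : ∃ n : ℕ, n = Int.gcd S Φ := ⟨_, rfl⟩
  have hnS : (n : ℤ) ∣ S := hn ▸ Int.gcd_dvd_left ..
  have hnΦ : (n : ℤ) ∣ Φ := hn ▸ Int.gcd_dvd_right ..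
  have hΦM : Φ ∣ 4 ^ (p * q) - 1 := ⟨(4 ^ p - 1) * K, by rw [hfac]; ring⟩
  have hnodd : ¬ 2 ∣ n := fun h => hoddM ((Int.natCast_dvd_natCast.2 h).trans (hnΦ.trans hΦM))
  have hn0 : n ≠ 0 := by rintro rfl; simp at hnodd
  -- A prime `l` of `n` dividing `4^p - 1` would be `q`, yet would divide `q - 1`. So 4 has order
  -- `pq` mod `l`.
  have hnN : n ≡ 1 [MOD p * q] := by
    refine Nat.modEq_one_of_forall_prime_dvd hn0 fun l hl hln => ?_
    have hlS : (l : ℤ) ∣ S := (Int.natCast_dvd_natCast.2 hln).trans hnS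
    have hlΦ : (l : ℤ) ∣ Φ := (Int.natCast_dvd_natCast.2 hln).trans hnΦ
    have hlB := hprB l hl hlS
    have hl3 : ¬ 3 ∣ l := fun h => hpr3 ((Int.natCast_dvd_natCast.2 h).trans hlS)
    have hlA : ¬ (l : ℤ) ∣ 4 ^ p - 1 := by
      intro hlA
      have h1 : (l : ℤ) ∣ q := (dvd_sub_right (hlΦ.mul_right K)).1 (hlA.trans hmod)
      have h2 : l = q := (Nat.prime_dvd_prime_iff_eq hl hq).1 (by exact_mod_cast h1)
      subst h2
      have h3 : l ∣ l - 1 := by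
        have := hsubA hlS hlA (hc3 hl3)
        zify [hq.one_le]
        exact this
      have := Nat.le_of_dvd (by omega) h3
      omega
    have := mul_dvd_sub_one hl hp hq (hlΦ.trans hΦM) hlA hlB
    exact ((Nat.modEq_iff_dvd' hl.one_le).2 this).symm
  obtain ⟨t, ht⟩ : ∃ t : ℕ, n = 1 + 2 * (p * q) * t := by
    have h1 : p * q ∣ n - 1 := (Nat.modEq_iff_dvd' (by omega)).1 hnN.symm
    have hodd : ¬ 2 ∣ p * q := by
      rw [Nat.prime_two.dvd_mul]; omega
    have h2 : 2 * (p * q) ∣ n - 1 :=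
      Nat.Coprime.mul_dvd_of_dvd_of_dvd ((Nat.Prime.coprime_iff_not_dvd Nat.prime_two).2 hodd)
        (by omega) h1
    obtain ⟨t, ht⟩ := h2
    exact ⟨t, by omega⟩
  have hG : Int.gcd S (4 ^ (p * q) - 1) ≤ d * n := by
    have hcop : IsCoprime (Int.gcd S (4 ^ (p * q) - 1) : ℤ) K := by
      rw [Int.isCoprime_iff_gcd_eq_one]
      by_contra hne
      obtain ⟨l, hl, hlg⟩ := Nat.exists_prime_and_dvd hne
      have hl1 := (Int.natCast_dvd_natCast.2 hlg).trans (Int.gcd_dvd_left ..)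
      have hl2 := (Int.natCast_dvd_natCast.2 hlg).trans (Int.gcd_dvd_right ..)
      exact hprB l hl (hl1.trans (Int.gcd_dvd_left ..)) (hK ▸ hl2.mul_right 3)
    have h1 : (Int.gcd S (4 ^ (p * q) - 1) : ℤ) ∣ (4 ^ p - 1) * Φ := by
      refine hcop.dvd_of_dvd_mul_right ?_
      rw [mul_assoc, ← hfac]
      exact Int.gcd_dvd_right ..
    have h2 : Int.gcd S (4 ^ (p * q) - 1) ∣ d * n := by
      have e : Int.gcd S ((4 ^ p - 1) * Φ) ∣ d * n := by
        rw [hd, hn, Int.gcd, Int.gcd, Int.gcd, Int.natAbs_mul]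
        exact Nat.gcd_mul_right_dvd_mul_gcd _ _ _
      exact (Int.dvd_gcd (Int.gcd_dvd_left ..) h1).trans e
    exact Nat.le_of_dvd (Nat.mul_pos hd0 (Nat.pos_of_ne_zero hn0)) h2
  -- With `S ≡ 0` and `γ² ≡ N`, the relation becomes linear, `(4β+6)γ ≡ 9 + (1-4ε)N`; squaring
  -- removes `γ`.
  have hW : (n : ℤ) ∣ p * q * (4 * β + 6) ^ 2 - (9 + (1 - 4 * ε) * (p * q)) ^ 2 := by
    have h1 : (n : ℤ) ∣ γ ^ 2 - p * q := hnΦ.trans hγ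
    have h2 : (n : ℤ) ∣ (2 * S - 3 + γ) ^ 2 - 4 * β * γ - 4 * ε * (p * q) := hnΦ.trans hrel
    obtain ⟨a, ha⟩ := h1
    obtain ⟨b, hb⟩ := h2
    obtain ⟨s, hs⟩ := hnS
    have h3 : (n : ℤ) ∣ (4 * β + 6) * γ - (9 + (1 - 4 * ε) * (p * q)) :=
      ⟨a - b + s * (4 * S - 12 + 4 * γ), by
        linear_combination ha - hb + (4 * S - 12 + 4 * γ) * hs⟩
    obtain ⟨c, hc⟩ := h3
    exact ⟨c * ((4 * β + 6) * γ + (9 + (1 - 4 * ε) * (p * q))) - (4 * β + 6) ^ 2 * a, by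
      linear_combination ((4 * β + 6) * γ + (9 + (1 - 4 * ε) * (p * q))) * hc -
        (4 * β + 6) ^ 2 * ha⟩
  refine lt_of_le_of_lt (by exact_mod_cast hG : (Int.gcd S (4 ^ (p * q) - 1) : ℤ) ≤ d * n) ?_
  have hnt : (n : ℤ) = 1 + 2 * (p * q) * t := by exact_mod_cast ht
  rw [hnt] at hW ⊢
  -- Both primes being 1 mod 8 is excluded, so `ε = 1` exactly when both are 5 mod 8.
  by_cases h5 : p % 8 = 5 ∧ q % 8 = 5
  · have e1 : ε = 1 := by rw [hε, if_neg (by omega), if_neg (by omega)]; rfl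
    refine mul_lt_of_dvd_pos h5.1 h5.2 hq hpq hβ hd0 hd4 hd1 (by positivity) ?_
    convert hW using 1
    rw [e1]; ring
  · have e1 : ε = -1 ∧ ((p : ℤ) * q) % 8 = 5 := by
      have hcases : (p % 8 = 1 ∧ q % 8 = 5) ∨ (p % 8 = 5 ∧ q % 8 = 1) := by omega
      rw [hε, Int.mul_emod]
      rcases hcases with ⟨h1, h2⟩ | ⟨h1, h2⟩
      · rw [show (p : ℤ) % 8 = 1 by omega, show (q : ℤ) % 8 = 5 by omega, h1, h2]
        norm_num
      · rw [show (p : ℤ) % 8 = 5 by omega, show (q : ℤ) % 8 = 1 by omega, h1, h2]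
        norm_num
    refine mul_lt_of_dvd_neg e1.2 ?_ hβ hd0 hd4 (by positivity) ?_
    · by_cases h : p = 5
      · subst h; push_cast; omega
      · have h1 : (13 : ℤ) ≤ p := by
          have : p ≠ 9 := by rintro rfl; norm_num at hp
          omega
        have h2 : (13 : ℤ) ≤ q := by omega
        nlinarith
    · convert hW using 1
      rw [e1.1]; ring

/-! ### Bounds for `r₁` and `r₂`. -/

/-- An odd divisor of `p + 3`, a multiple of 4, is at most `(p + 3) / 4`; and `p + 4 ≤ q`. -/
theorem rOne_le {p q : ℕ} (hp4 : p % 4 = 1) (hq4 : q % 4 = 1) (hpq : p < q) :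
    4 * rOne p q ≤ q - 1 := by
  have hodd : ¬ 2 ∣ rOne p q := by
    intro h
    have h1 : 2 ∣ 4 ^ q - 1 := h.trans (Nat.gcd_dvd_right _ _)
    have h2 : 2 ∣ 4 ^ q := dvd_pow (by norm_num) (by omega)
    have h3 : 0 < 4 ^ q := by positivity
    omega
  have h1 : rOne p q ∣ p + 3 := Nat.gcd_dvd_left _ _
  have h2 : 4 * rOne p q ∣ p + 3 :=
    Nat.Coprime.mul_dvd_of_dvd_of_dvd
      (Nat.Coprime.pow_left 2 ((Nat.Prime.coprime_iff_not_dvd Nat.prime_two).2 hodd)) (by omega) h1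
  have := Nat.le_of_dvd (by omega) h2
  omega

theorem rTwo_le {p q : ℕ} (hp : p ≠ 0) (hq4 : q % 4 = 1) (hq1 : 1 < q) :
    4 * rTwo p q ≤ q - 1 := by
  have hodd : ¬ 2 ∣ Nat.gcd (q - 1) (4 ^ p - 1) := by
    intro h
    have h1 : 2 ∣ 4 ^ p - 1 := h.trans (Nat.gcd_dvd_right _ _)
    have h2 : 2 ∣ 4 ^ p := dvd_pow (by norm_num) hp
    have h3 : 0 < 4 ^ p := by positivity
    omega
  have h2 : 4 * Nat.gcd (q - 1) (4 ^ p - 1) ∣ q - 1 :=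
    Nat.Coprime.mul_dvd_of_dvd_of_dvd
      (Nat.Coprime.pow_left 2 ((Nat.Prime.coprime_iff_not_dvd Nat.prime_two).2 hodd)) (by omega)
      (Nat.gcd_dvd_left _ _)
  have := Nat.le_of_dvd (by omega) h2
  unfold rTwo
  split_ifs <;> omega

/-! ### From the gcd bound to the complexity. -/

/-- Integrality gives `G + 1 ≤ c`, and with `c < 4^N` this absorbs the `-1`: `(4^N - 1) / G > 4^N /
c`. -/
theorem lt_adicComplexity_of_gcd_lt {N : ℕ} {s : ℕ → ZMod 4} {c : ℕ} (hN : N ≠ 0)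
    (hc : c < 4 ^ N)
    (hG : Int.gcd ((generatingPoly 4 N s).eval 4) (4 ^ N - 1) < c) :
    (N : ℝ) - Real.logb 4 c < adicComplexity 4 N s := by
  unfold adicComplexity
  refine lt_of_lt_of_le ?_ (Int.le_ceil _)
  push_cast
  set G := Int.gcd ((generatingPoly 4 N s).eval 4) (4 ^ N - 1)
  have hG0 : 0 < G := by
    refine Int.gcd_pos_of_ne_zero_right _ ?_
    have : (1 : ℤ) < 4 ^ N := one_lt_pow₀ (by norm_num) hN
    omega
  have hGr : (0 : ℝ) < G := by exact_mod_cast hG0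
  have hcr : (0 : ℝ) < c := by exact_mod_cast hG0.trans hG
  have h4 : (0 : ℝ) < 4 ^ N := by positivity
  have e : (N : ℝ) - Real.logb 4 c = Real.logb 4 (4 ^ N / c) := by
    rw [Real.logb_div h4.ne' hcr.ne', Real.logb_pow, Real.logb_self_eq_one (by norm_num), mul_one]
  rw [e]
  refine Real.logb_lt_logb (by norm_num) (by positivity) ?_
  rw [div_lt_div_iff₀ hcr hGr]
  have h1 : (G : ℝ) + 1 ≤ c := by exact_mod_cast hG
  have h2 : (c : ℝ) < 4 ^ N := by exact_mod_cast hc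
  nlinarith [mul_le_mul_of_nonneg_left h1 h4.le]

theorem mainTheorem2 (p q : ℕ) (hp : p.Prime) (hq : q.Prime) (hp2 : Odd p) (hq2 : Odd q)
    (hgcd : Nat.gcd (p - 1) (q - 1) = 4) (hpq : p < q)
    (g h : ℤ) (hgp : IsPrimitiveRootModPrime g p) (hgq : IsPrimitiveRootModPrime g q)
    (hhp : h ≡ g [ZMOD (p : ℤ)]) (hhq : h ≡ 1 [ZMOD (q : ℤ)]) :
    (adicComplexity 4 (p * q) (twoPrimeQuaternary p q g h) : ℝ) >
        (p : ℝ) * q - Real.logb 4 ((p : ℝ) * (q : ℝ) ^ 2) - 1 ∧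
      ((max (rOne p q) (rTwo p q) : ℕ) : ℝ) ≤ ((q : ℝ) - 1) / 4 ∧
      (6 * (p : ℝ) * q + 1) * ((max (rOne p q) (rTwo p q) : ℕ) : ℝ) <
        3 * (p : ℝ) * (q : ℝ) ^ 2 / 2 := by
  have := Fact.mk hp
  have := Fact.mk hq
  have hp2' := hp.two_le
  have hdp : 4 ∣ p - 1 := hgcd ▸ Nat.gcd_dvd_left _ _
  have hdq : 4 ∣ q - 1 := hgcd ▸ Nat.gcd_dvd_right _ _
  have hp4 : p % 4 = 1 := by omega
  have hq4 : q % 4 = 1 := by omega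
  -- Otherwise 8 would divide `gcd(p-1, q-1) = 4`.
  have h8 : ¬ (p % 8 = 1 ∧ q % 8 = 1) := by
    rintro ⟨h1, h2⟩
    have : 8 ∣ Nat.gcd (p - 1) (q - 1) := Nat.dvd_gcd (by omega) (by omega)
    rw [hgcd] at this
    omega
  have hcop : p.Coprime q := (Nat.coprime_primes hp hq).2 hpq.ne
  have hhp' : (h : ZMod p) = g := (ZMod.intCast_eq_intCast_iff _ _ _).2 hhp
  have hhq' : (h : ZMod q) = 1 := by
    simpa using (ZMod.intCast_eq_intCast_iff _ _ _).2 hhq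
  have hI4 : Complex.I ^ 4 = 1 := Complex.I_pow_four
  obtain ⟨χ, hχ⟩ := ZMod.exists_mulChar_apply_eq hgp hdp hI4 (by norm_num)
  obtain ⟨φ, hφ⟩ := ZMod.exists_mulChar_apply_eq hgq hdq (ω := -Complex.I)
    (by rw [Even.neg_pow (by decide), hI4]) (by norm_num)
  have hχ2 : χ (g : ZMod p) ^ 2 = -1 := by rw [hχ, Complex.I_sq]
  have hφ2 : φ (g : ZMod q) ^ 2 = -1 := by rw [hφ, neg_sq, Complex.I_sq]
  have h2 := MulChar.sq_ne_one_of_apply hχ2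
  have h2' := MulChar.sq_ne_one_of_apply hφ2
  have hgcdlt : (Int.gcd ((generatingPoly 4 (p * q) (twoPrimeQuaternary p q g h)).eval 4)
      (4 ^ (p * q) - 1) : ℤ) < 4 * (p * q) * q :=
    gcd_four_pow_sub_one_lt hp4 hq4 h8 hpq
      (two_mul_eval_modEq_left hcop hgcd hgp hgq hhp' hhq' hχ hφ h2')
      (two_mul_eval_modEq_right hcop hgcd hgp hgq hhp' hhq' hχ hφ h2) rfl
      (exists_cyclotomic_eval_dvd hcop hgcd hgp hgq hhp' hhq' hχ hφ
        (MulChar.pow_four_eq_one_of_apply hgp hχ2) h2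
        (MulChar.pow_four_eq_one_of_apply hgq hφ2) h2'
        (by rw [MulChar.apply_neg_one_of_apply hgp hχ2 hp4,
              MulChar.apply_neg_one_of_apply hgq hφ2 hq4]; push_cast; rfl))
  have hr : 4 * max (rOne p q) (rTwo p q) ≤ q - 1 := by
    have h1 := rOne_le hp4 hq4 hpq
    have h2 := rTwo_le (p := p) hp.ne_zero hq4 hq.one_lt
    omega
  have hr' : ((max (rOne p q) (rTwo p q) : ℕ) : ℝ) ≤ ((q : ℝ) - 1) / 4 := by
    have h1 : 4 * max (rOne p q) (rTwo p q) + 1 ≤ q := by omega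
    have h2 : 4 * ((max (rOne p q) (rTwo p q) : ℕ) : ℝ) + 1 ≤ q := by exact_mod_cast h1
    linarith
  have hp5 : (5 : ℝ) ≤ p := by exact_mod_cast (by omega : 5 ≤ p)
  have hq5 : (5 : ℝ) ≤ q := by exact_mod_cast (by omega : 5 ≤ q)
  refine ⟨?_, hr', ?_⟩
  · have hN : p * q ≠ 0 := mul_ne_zero hp.ne_zero hq.ne_zero
    -- `4Nq < (2N)² ≤ (2^N)²`.
    have hc : 4 * (p * q) * q < 4 ^ (p * q) := by
      have h1 : 2 * (p * q) ≤ 2 ^ (p * q) := by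
        obtain ⟨k, hk⟩ := Nat.exists_eq_succ_of_ne_zero hN
        have := Nat.lt_two_pow_self (n := k)
        rw [hk, pow_succ]
        omega
      calc 4 * (p * q) * q < 4 * (p * q) * (p * q) :=
            Nat.mul_lt_mul_of_pos_left (lt_mul_of_one_lt_left hq.pos hp.one_lt) (by positivity)
        _ = (2 * (p * q)) ^ 2 := by ring
        _ ≤ (2 ^ (p * q)) ^ 2 := Nat.pow_le_pow_left h1 2
        _ = 4 ^ (p * q) := by rw [← pow_mul, mul_comm, pow_mul]; norm_num
    have := lt_adicComplexity_of_gcd_lt hN hc (by exact_mod_cast hgcdlt)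
    have e : Real.logb 4 ((4 * (p * q) * q : ℕ) : ℝ) =
        1 + Real.logb 4 ((p : ℝ) * (q : ℝ) ^ 2) := by
      rw [show ((4 * (p * q) * q : ℕ) : ℝ) = 4 * ((p : ℝ) * (q : ℝ) ^ 2) by push_cast; ring,
        Real.logb_mul (by norm_num) (by positivity), Real.logb_self_eq_one (by norm_num)]
    rw [e] at this
    push_cast at this
    linarith
  · have h1 : (6 * (p : ℝ) * q + 1) * ((max (rOne p q) (rTwo p q) : ℕ) : ℝ) ≤
        (6 * (p : ℝ) * q + 1) * (((q : ℝ) - 1) / 4) :=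
      mul_le_mul_of_nonneg_left hr' (by positivity)
    nlinarith
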